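/- Let $M$ be an oriented smooth $4$-manifold. For a triple $\eta=(\eta_1,\eta_2,\eta_3)$ of $2$-forms let $q(\eta)_{ij}=\eta_i\wedge\eta_j$, $\operatorname{tr}q(\eta)=\eta_1^2+\eta_2^2+\eta_3^2$ and $Q(\eta)_{ij}=\eta_i\wedge\eta_j-\frac13(\eta_1^2+\eta_2^2+\eta_3^2)\delta_{ij}$, which are matrices with values in $\Lambda^4T^*M$, except for the trace, which is a $4$-form. A \emph{symplectic triple} is a triple of symplectic forms on $M$ for which $q$ is positive-definite at every point (with respect to the orientation of $M$); it is a \emph{hyperK\"ahler triple} if moreover $q$ is a multiple of the identity matrix at every point. Let $\omega=(\omega_1,\omega_2,\omega_3)$ be a symplectic triple on $M$, and write $q=q(\omega)$ and $p=q^{-1}$ (a matrix with values in $\Lambda^4TM$). There is a unique smooth Riemannian metric $g=g(\omega)$ on $M$ whose bundle $\Lambda^2_+(g)$ of self-dual $2$-forms is spanned at every point by $\omega_1,\omega_2,\omega_3$ and whose volume form is $\operatorname{tr}q$. Let $d^*$ be the codifferential of $g$ on $1$-forms and $d_+\alpha=\frac12(d\alpha+{*_g}d\alpha)$ the self-dual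 part of $d\alpha$. For a triple $a=(a_1,a_2,a_3)$ of smooth $1$-forms put $R=\frac12Q(\omega)+\frac12Q(da)$ and define (summing over repeated indices) $$\mathcal F(a)_j=\bigl(d^*a_j,\; d_+a_j+R_{js}p_{sk}\omega_k\bigr),\qquad j=1,2,3,$$ where the factors $\Lambda^4T^*M$ of $R$ and $\Lambda^4TM$ of $p$ are contracted. The second components of $\mathcal F(a)$ are self-dual with respect to $g$, and the following hold. (i) If $a$ is a triple of smooth $1$-forms such that $\omega+da$ is a symplectic triple and $\mathcal F(a)=0$, then $\omega+da$ is a hyperK\"ahler triple. (ii) The linearization of $\mathcal F$ at $a=0$ is the tripled Dirac operator $D=d^*+d_+$ of the metric $g(\omega)$: for every triple $b$ of smooth $1$-forms, $\frac{d}{dt}\big|_{t=0}\mathcal F(tb)_j=(d^*b_j,\,d_+b_j)$ at every point of $M$, for $j=1,2,3$. -/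

import Mathlib

open scoped Manifold Topology

noncomputable section

namespace HKTriple

/-! ### Pointwise multilinear algebra -/

section LinearAlgebra

variable {V : Type*} [AddCommGroup V] [Module ℝ V] [TopologicalSpace V]

theorem two_self (α : V [⋀^Fin 2]→L[ℝ] ℝ) (u : V) : α ![u, u] = 0 :=
  α.map_eq_zero_of_eq ![u, u] (i := 0) (j := 1) rfl (by decide)

theorem two_swap (α : V [⋀^Fin 2]→L[ℝ] ℝ) (u v : V) : α ![u, v] = - α ![v, u] := by
  have h := α.toAlternatingMap.map_swap ![v, u] (i := 0) (j := 1) (by decide)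
  have e : (![v, u] ∘ (Equiv.swap (0 : Fin 2) 1)) = ![u, v] := by
    funext i; fin_cases i <;> simp
  rw [e] at h
  exact h

theorem two_add_left (α : V [⋀^Fin 2]→L[ℝ] ℝ) (u u' v : V) :
    α ![u + u', v] = α ![u, v] + α ![u', v] := α.toAlternatingMap.map_vecCons_add _ _ _

theorem two_smul_left (α : V [⋀^Fin 2]→L[ℝ] ℝ) (c : ℝ) (u v : V) :
    α ![c • u, v] = c * α ![u, v] := α.toAlternatingMap.map_vecCons_smul _ _ _

theorem two_add_right (α : V [⋀^Fin 2]→L[ℝ] ℝ) (u v v' : V) :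
    α ![u, v + v'] = α ![u, v] + α ![u, v'] := by
  rw [two_swap, two_add_left, two_swap α v, two_swap α v']; ring

theorem two_smul_right (α : V [⋀^Fin 2]→L[ℝ] ℝ) (c : ℝ) (u v : V) :
    α ![u, c • v] = c * α ![u, v] := by
  rw [two_swap, two_smul_left, two_swap α v]; ring

/-- The shuffle formula for the value of `α ∧ β` on four vectors, for `2`-forms `α`, `β`. -/
def wedgeFun (α β : V [⋀^Fin 2]→L[ℝ] ℝ) (v : Fin 4 → V) : ℝ :=
  α ![v 0, v 1] * β ![v 2, v 3] - α ![v 0, v 2] * β ![v 1, v 3]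
    + α ![v 0, v 3] * β ![v 1, v 2] + α ![v 1, v 2] * β ![v 0, v 3]
    - α ![v 1, v 3] * β ![v 0, v 2] + α ![v 2, v 3] * β ![v 0, v 1]

variable [IsTopologicalAddGroup V] [ContinuousSMul ℝ V] [T2Space V] [FiniteDimensional ℝ V]

/-- On a finite-dimensional Hausdorff space every alternating form is continuous. -/
theorem continuous_alternating {n : ℕ} (f : V [⋀^Fin n]→ₗ[ℝ] ℝ) : Continuous f := by
  classical
  let b := Module.finBasis ℝ V
  have h : (f : (Fin n → V) → ℝ) = fun v =>
      ∑ r : Fin n → Fin (Module.finrank ℝ V),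
        (∏ i, b.coord (r i) (v i)) • f.toMultilinearMap (fun i => b (r i)) := by
    funext v
    have hv : v = fun i => ∑ j, b.coord j (v i) • b j := by
      funext i
      exact (b.sum_repr (v i)).symm
    conv_lhs => rw [hv]
    rw [← AlternatingMap.coe_multilinearMap, MultilinearMap.map_sum]
    refine Finset.sum_congr rfl fun r _ => ?_
    rw [MultilinearMap.map_smul_univ]
  rw [h]
  refine continuous_finsetSum _ fun r _ => ?_
  refine Continuous.smul (f := fun v : Fin n → V => ∏ i, b.coord (r i) (v i)) ?_ continuous_const
  refine continuous_finsetProd _ fun i _ => ?_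
  have hc : Continuous fun v : V => b.coord (r i) v :=
    LinearMap.continuous_of_finiteDimensional (b.coord (r i))
  exact hc.comp (continuous_apply i)

/-- An alternating form on a finite-dimensional space, as a continuous alternating form. -/
def toContinuousForm {n : ℕ} (f : V [⋀^Fin n]→ₗ[ℝ] ℝ) : V [⋀^Fin n]→L[ℝ] ℝ :=
  { f with cont := continuous_alternating f }

/-- The wedge product of two `2`-forms. -/
def wedge (α β : V [⋀^Fin 2]→L[ℝ] ℝ) : V [⋀^Fin 4]→L[ℝ] ℝ :=
  toContinuousForm
    { toFun := wedgeFun α β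
      map_update_add' := by
        intro inst v i x y
        have h : inst = instDecidableEqFin 4 := Subsingleton.elim _ _
        subst h
        fin_cases i <;> simp [wedgeFun, Function.update, two_add_left, two_add_right] <;> ring
      map_update_smul' := by
        intro inst v i c x
        have h : inst = instDecidableEqFin 4 := Subsingleton.elim _ _
        subst h
        fin_cases i <;> simp [wedgeFun, Function.update, two_smul_left, two_smul_right] <;> ring
      map_eq_zero_of_eq' := by
        intro v i j h hij
        have hα := two_swap α
        have hβ := two_swap β
        have sα := two_self α
        have sβ := two_self β
        fin_cases i <;> fin_cases j <;> first | exact absurd rfl hij | skip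
        all_goals
          simp only [Fin.zero_eta, Fin.mk_one, Fin.reduceFinMk] at h
          simp only [wedgeFun]
          generalize v 0 = a at *
          generalize v 1 = b at *
          generalize v 2 = c at *
          generalize v 3 = d at *
          subst h
          simp only [sα, sβ]
          grind }

@[simp]
theorem wedge_apply (α β : V [⋀^Fin 2]→L[ℝ] ℝ) (v : Fin 4 → V) :
    wedge α β v = wedgeFun α β v := rfl

end LinearAlgebra

/-! ### Smooth 4-manifolds: forms, orientations, metrics -/

/-- The model space of a `4`-manifold. -/
abbrev E4 : Type := EuclideanSpace ℝ (Fin 4)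

section Manifold

variable {M : Type*} [TopologicalSpace M] [ChartedSpace E4 M]

/-- The tangent space of the `4`-manifold `M` at `x`. -/
abbrev Tan (x : M) : Type := TangentSpace (𝓡 4) x

instance (x : M) : T2Space (Tan x) := inferInstanceAs (T2Space E4)

instance (x : M) : FiniteDimensional ℝ (Tan x) := inferInstanceAs (FiniteDimensional ℝ E4)

theorem finrank_tan (x : M) : Module.finrank ℝ (Tan x) = 4 :=
  finrank_euclideanSpace_fin (𝕜 := ℝ) (n := 4)

/-- The derivative at `x` of the chart around `x₀`. -/
def chartDeriv (x₀ x : M) : Tan x →L[ℝ] E4 :=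
  mfderiv (𝓡 4) 𝓘(ℝ, E4) (extChartAt (𝓡 4) x₀) x

/-- The derivative at `y` of the inverse of the chart around `x₀`. -/
def chartSymmDeriv (x₀ : M) (y : E4) : E4 →L[ℝ] Tan ((extChartAt (𝓡 4) x₀).symm y) :=
  mfderiv 𝓘(ℝ, E4) (𝓡 4) (extChartAt (𝓡 4) x₀).symm y

variable (M) in
/-- Fields of alternating `k`-forms on `M`, with no regularity required. -/
abbrev FormField (k : ℕ) : Type _ := ∀ x : M, Tan x [⋀^Fin k]→L[ℝ] ℝ

/-- The expression of a form in the chart around `x₀`: its pull-back by the inverse chart. -/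
def localRep {k : ℕ} (α : FormField M k) (x₀ : M) (y : E4) : E4 [⋀^Fin k]→L[ℝ] ℝ :=
  (α ((extChartAt (𝓡 4) x₀).symm y)).compContinuousLinearMap (chartSymmDeriv x₀ y)

/-- A form is smooth if its coefficients in charts are smooth. -/
def IsSmoothForm {k : ℕ} (α : FormField M k) : Prop :=
  ∀ x₀ : M, ContDiffOn ℝ (⊤ : ℕ∞) (localRep α x₀) (extChartAt (𝓡 4) x₀).target

/-- The exterior derivative, computed at `x` in the chart around `x`. -/
def extD {k : ℕ} (α : FormField M k) : FormField M (k + 1) := fun x =>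
  (extDeriv (localRep α x) (extChartAt (𝓡 4) x x)).compContinuousLinearMap (chartDeriv x x)

/-- Given an orientation of each tangent space, `v` is a positively oriented basis at `x`. -/
def IsPositiveFrame (o : ∀ x : M, Orientation ℝ (Tan x) (Fin 4)) (x : M)
    (v : Fin 4 → Tan x) : Prop :=
  ∃ b : Module.Basis (Fin 4) ℝ (Tan x), ⇑b = v ∧ b.orientation = o x

variable (M) in
/-- An orientation of `M`: orientations of the tangent spaces that are locally constant in charts,
i.e. a frame which has constant coefficients in a chart around `x₀` and is positive at `x₀` is
positive near `x₀`. -/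
structure ManifoldOrientation where
  /-- the orientation of each tangent space -/
  orient : ∀ x : M, Orientation ℝ (Tan x) (Fin 4)
  /-- local constancy -/
  locally_constant : ∀ (x₀ : M) (v : Fin 4 → E4),
    IsPositiveFrame orient x₀ (fun i => chartSymmDeriv x₀ (extChartAt (𝓡 4) x₀ x₀) (v i)) →
    ∀ᶠ x in 𝓝 x₀,
      IsPositiveFrame orient x (fun i => chartSymmDeriv x₀ (extChartAt (𝓡 4) x₀ x) (v i))

variable [IsManifold (𝓡 4) (⊤ : ℕ∞) M]

variable (M) in
/-- Smooth Riemannian metrics on `M`. -/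
abbrev Metric : Type _ := Bundle.ContMDiffRiemannianMetric (𝓡 4) (⊤ : ℕ∞) E4 (fun x : M => Tan x)

/-- `e` is a positively oriented `g`-orthonormal basis of the tangent space at `x`. -/
def IsOrientedOrthonormal (o : ManifoldOrientation M) (g : Metric M) (x : M)
    (e : Module.Basis (Fin 4) ℝ (Tan x)) : Prop :=
  e.orientation = o.orient x ∧ ∀ i j, g.inner x (e i) (e j) = if i = j then 1 else 0

theorem exists_isOrientedOrthonormal (o : ManifoldOrientation M) (g : Metric M) (x : M) :
    ∃ e : Module.Basis (Fin 4) ℝ (Tan x), IsOrientedOrthonormal o g x e := by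
  let c : InnerProductSpace.Core ℝ (Tan x) := g.toRiemannianMetric.toCore x
  let _ : NormedAddCommGroup (Tan x) := c.toNormedAddCommGroup
  let _ : InnerProductSpace ℝ (Tan x) := InnerProductSpace.ofCore c.toCore
  let b : OrthonormalBasis (Fin 4) ℝ (Tan x) :=
    (stdOrthonormalBasis ℝ (Tan x)).reindex (finCongr (finrank_tan x))
  let b' := b.adjustToOrientation (o.orient x)
  refine ⟨b'.toBasis, b.orientation_adjustToOrientation (o.orient x), fun i j => ?_⟩
  have h := orthonormal_iff_ite.mp b'.orthonormal i j
  rw [OrthonormalBasis.coe_toBasis]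
  exact h

/-- A choice of positively oriented `g`-orthonormal basis at each point; the constructions below
do not depend on the choice. -/
def onFrame (o : ManifoldOrientation M) (g : Metric M) (x : M) :
    Module.Basis (Fin 4) ℝ (Tan x) :=
  (exists_isOrientedOrthonormal o g x).choose

theorem onFrame_spec (o : ManifoldOrientation M) (g : Metric M) (x : M) :
    IsOrientedOrthonormal o g x (onFrame o g x) :=
  (exists_isOrientedOrthonormal o g x).choose_spec

/-- The Riemannian volume form `dμ_g`. -/
def volForm (o : ManifoldOrientation M) (g : Metric M) : FormField M 4 := fun x =>
  toContinuousForm (onFrame o g x).det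

/-- The Hodge star from `1`-forms to `3`-forms: `*α = ∑ i, α(e_i) vol(e_i, ·, ·, ·)`. -/
def star₁ (o : ManifoldOrientation M) (g : Metric M) (α : FormField M 1) : FormField M 3 :=
  fun x => toContinuousForm
    (∑ i, α x ![onFrame o g x i] •
      (onFrame o g x).det.curryLeft (onFrame o g x i))

/-- The Hodge star on `2`-forms at a point:
`*α = (1/2) ∑ i j, α(e_i, e_j) vol(e_i, e_j, ·, ·)`. -/
def star₂ (o : ManifoldOrientation M) (g : Metric M) (x : M)
    (α : Tan x [⋀^Fin 2]→L[ℝ] ℝ) : Tan x [⋀^Fin 2]→L[ℝ] ℝ :=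
  toContinuousForm
    ((1 / 2 : ℝ) • ∑ i, ∑ j, α ![onFrame o g x i, onFrame o g x j] •
      ((onFrame o g x).det.curryLeft (onFrame o g x i)).curryLeft (onFrame o g x j))

/-- The Hodge star from `4`-forms to functions: `*(f dμ_g) = f`. -/
def star₄ (o : ManifoldOrientation M) (g : Metric M) (μ : FormField M 4) : M → ℝ :=
  fun x => μ x (onFrame o g x)

/-- The fibre at `x` of the bundle `Λ²₊(g)` of self-dual `2`-forms. -/
def selfDual (o : ManifoldOrientation M) (g : Metric M) (x : M) :
    Set (Tan x [⋀^Fin 2]→L[ℝ] ℝ) :=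
  {α | star₂ o g x α = α}

/-- The codifferential `d* = - * d *` on `1`-forms (in dimension four). -/
def codiff (o : ManifoldOrientation M) (g : Metric M) (α : FormField M 1) : M → ℝ :=
  fun x => - star₄ o g (extD (star₁ o g α)) x

/-- `d₊α`, the self-dual part `(dα + *dα)/2` of `dα`. -/
def dPlus (o : ManifoldOrientation M) (g : Metric M) (α : FormField M 1) : FormField M 2 :=
  fun x => (1 / 2 : ℝ) • (extD α x + star₂ o g x (extD α x))

/-! ### Triples -/

variable (M) in
/-- Triples of `k`-forms. -/
abbrev Triple (k : ℕ) : Type _ := Fin 3 → FormField M k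

/-- The triple of exterior derivatives. -/
def tripleD (a : Triple M 1) : Triple M 2 := fun j => extD (a j)

/-- The matrix `q_{ij} = ω_i ∧ ω_j` of `4`-forms. -/
def qForm (ω : Triple M 2) (i j : Fin 3) : FormField M 4 := fun x => wedge (ω i x) (ω j x)

/-- `tr q = ω₁² + ω₂² + ω₃²`. -/
def trQ (ω : Triple M 2) : FormField M 4 := fun x => ∑ i, qForm ω i i x

/-- The trace-free part `Q(ω)_{ij} = ω_i ∧ ω_j - (1/3)(ω₁² + ω₂² + ω₃²) δ_{ij}`. -/
def tracefreeQ (ω : Triple M 2) (i j : Fin 3) : FormField M 4 := fun x =>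
  qForm ω i j x - (if i = j then (1 / 3 : ℝ) • trQ ω x else 0)

/-- A symplectic form: a smooth closed nondegenerate `2`-form. -/
structure IsSymplecticForm (α : FormField M 2) : Prop where
  smooth : IsSmoothForm α
  closed : extD α = 0
  nondegenerate : ∀ (x : M) (u : Tan x), (∀ v : Tan x, α x ![u, v] = 0) → u = 0

/-- A symplectic triple: three symplectic forms such that the matrix `q`, evaluated on any
positively oriented basis of any tangent space, is positive definite. -/
structure IsSymplecticTriple (o : ManifoldOrientation M) (ω : Triple M 2) : Prop where
  symplectic : ∀ j, IsSymplecticForm (ω j)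
  posDef : ∀ (x : M) (e : Module.Basis (Fin 4) ℝ (Tan x)), e.orientation = o.orient x →
    (Matrix.of fun i j => qForm ω i j x e).PosDef

/-- A hyperKähler triple: a symplectic triple for which `q` is, at every point, a multiple of the
identity matrix (the multiple being a `4`-form). -/
structure IsHyperkahlerTriple (o : ManifoldOrientation M) (ω : Triple M 2) : Prop where
  isSymplecticTriple : IsSymplecticTriple o ω
  proportional : ∀ x : M, ∃ μ : Tan x [⋀^Fin 4]→L[ℝ] ℝ,
    ∀ i j, qForm ω i j x = if i = j then μ else 0

/-- `g` is the metric determined by the triple `ω`: its bundle of self-dual `2`-forms is spanned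
by `ω₁, ω₂, ω₃`, and its volume form is `tr q`. -/
structure IsTripleMetric (o : ManifoldOrientation M) (ω : Triple M 2) (g : Metric M) : Prop where
  selfDual_eq : ∀ x : M, selfDual o g x =
    (Submodule.span ℝ (Set.range fun j => ω j x) : Set (Tan x [⋀^Fin 2]→L[ℝ] ℝ))
  volForm_eq : volForm o g = trQ ω

/-- A choice of positively oriented basis of each tangent space. -/
def positiveBasis (o : ManifoldOrientation M) (x : M) : Module.Basis (Fin 4) ℝ (Tan x) :=
  (o.orient x).someBasis (by rw [finrank_tan, Fintype.card_fin])

/-- The matrix of coefficients at `x` of a matrix of `4`-forms, i.e. its contraction with the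
`4`-vector `ν⁻¹` given by a positively oriented basis. -/
def coeffMatrix (o : ManifoldOrientation M) (A : Fin 3 → Fin 3 → FormField M 4) (x : M) :
    Matrix (Fin 3) (Fin 3) ℝ :=
  Matrix.of fun i j => A i j x (positiveBasis o x)

/-- The matrix `R = (1/2) Q(ω) + (1/2) Q(da)` of `4`-forms. -/
def RForm (ω : Triple M 2) (a : Triple M 1) (i j : Fin 3) : FormField M 4 := fun x =>
  (1 / 2 : ℝ) • tracefreeQ ω i j x + (1 / 2 : ℝ) • tracefreeQ (tripleD a) i j x

/-- The matrix of functions `(R p)_{jk} = R_{js} p_{sk}`, where `p = q⁻¹`.  The values of `R` are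
`4`-forms and those of `p` are `4`-vectors, so the product does not depend on the basis in which
the coefficients are taken. -/
def RpMatrix (o : ManifoldOrientation M) (ω : Triple M 2) (a : Triple M 1) (x : M) :
    Matrix (Fin 3) (Fin 3) ℝ :=
  coeffMatrix o (RForm ω a) x * (coeffMatrix o (qForm ω) x)⁻¹

/-- The nonlinear map `F(a)_j = (d* a_j, d₊ a_j + R_{js} p_{sk} ω_k)`. -/
def nonlinearOp (o : ManifoldOrientation M) (g : Metric M) (ω : Triple M 2) (a : Triple M 1) :
    (Fin 3 → M → ℝ) × Triple M 2 :=
  (fun j => codiff o g (a j),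
    fun j x => dPlus o g (a j) x + ∑ k, RpMatrix o ω a x j k • ω k x)

/-- The tripled Dirac operator `D = d* + d₊`. -/
def diracOp (o : ManifoldOrientation M) (g : Metric M) (a : Triple M 1) :
    (Fin 3 → M → ℝ) × Triple M 2 :=
  (fun j => codiff o g (a j), fun j => dPlus o g (a j))

end Manifold
end HKTriple

end

/-! Existence of the metric is a pointwise matter. Factor `q = A * Aᵀ`; the triple `A⁻¹ω` has the
identity as its wedge matrix, and `exists_selfDual_basis_of_orthonormal` builds by hand an oriented
frame in which such a triple is self-dual. Linear combinations stay self-dual, so `ω` is self-dual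
in the same frame, and a rescaling makes `tr q` equal to 1 on it. The metric is the one for which
this frame is orthonormal.

The frame is chosen at each point with no regularity, so uniqueness and smoothness come from an
Urbantke-type formula. The 4-form `metricForm ω u v`, cubic in `ω`, equals the inner product of `u`
and `v` times a scalar (`metricForm_frame`), and up to sign that scalar can be read off from the
determinant and trace of `q`. Positivity fixes the sign, which gives `frameInner_unique`;
`frameInner_eq_formula` writes the metric as a smooth function of the coefficients of `ω`.

For (i), `F(a) = 0` reads `d₊a_j = -(Rp)_{jk} ω_k`. A self-dual form wedges to zero with an
anti-self-dual one, hence `ω_i ∧ da_j = ω_i ∧ d₊a_j = -(Rpq)_{ji} = -R_{ji}`. Expanding `(ω_i +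
da_i) ∧ (ω_j + da_j)`, the mixed terms contribute `-2R = -Q(ω) - Q(da)`, which cancels the
trace-free parts and leaves a multiple of the identity.

For (ii), `R` is a constant plus a term quadratic in `a`, so only `d*` and `d₊` survive at first
order. -/

noncomputable section

namespace HKTriple

/-! ### Two-forms and the Hodge star in a frame. -/

section LinearAlgebra

variable {V : Type*} [AddCommGroup V] [Module ℝ V] [TopologicalSpace V]

/-- A `2`-form is determined by its six values on pairs of vectors of a basis. -/
theorem two_ext (e : Module.Basis (Fin 4) ℝ V) {α β : V [⋀^Fin 2]→L[ℝ] ℝ}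
    (h₀₁ : α ![e 0, e 1] = β ![e 0, e 1]) (h₀₂ : α ![e 0, e 2] = β ![e 0, e 2])
    (h₀₃ : α ![e 0, e 3] = β ![e 0, e 3]) (h₁₂ : α ![e 1, e 2] = β ![e 1, e 2])
    (h₁₃ : α ![e 1, e 3] = β ![e 1, e 3]) (h₂₃ : α ![e 2, e 3] = β ![e 2, e 3]) : α = β := by
  have key : ∀ i j, α ![e i, e j] = β ![e i, e j] := by
    intro i j
    fin_cases i <;> fin_cases j <;>
      first
        | (simp only [Fin.zero_eta, Fin.mk_one, Fin.reduceFinMk, two_self]; done)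
        | (simp only [Fin.zero_eta, Fin.mk_one, Fin.reduceFinMk]; assumption)
        | (simp only [Fin.zero_eta, Fin.mk_one, Fin.reduceFinMk]
           rw [two_swap α, two_swap β]; congr 1)
  apply ContinuousAlternatingMap.toAlternatingMap_injective
  refine Module.Basis.ext_alternating e fun v _ => ?_
  have hv : (fun i => e (v i)) = ![e (v 0), e (v 1)] := by
    funext i; fin_cases i <;> rfl
  rw [hv]
  exact key _ _

/-- The value of a `4`-form on a tuple of vectors, in terms of its value on a basis. -/
theorem four_apply (e : Module.Basis (Fin 4) ℝ V) (η : V [⋀^Fin 4]→L[ℝ] ℝ) (v : Fin 4 → V) :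
    η v = η e * e.det v := by
  have h := congrArg (fun f => f v) (AlternatingMap.eq_smul_basis_det e η.toAlternatingMap)
  simpa using h

theorem four_ext (e : Module.Basis (Fin 4) ℝ V) {η ζ : V [⋀^Fin 4]→L[ℝ] ℝ} (h : η e = ζ e) :
    η = ζ := by
  ext v
  rw [four_apply e η, four_apply e ζ, h]

/-- A `2`-form is self-dual with respect to a frame if its coefficients are those of a form which
is self-dual for the metric and orientation making the frame oriented and orthonormal. -/
structure IsSelfDualIn (e : Fin 4 → V) (α : V [⋀^Fin 2]→L[ℝ] ℝ) : Prop where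
  h₂₃ : α ![e 2, e 3] = α ![e 0, e 1]
  h₁₃ : α ![e 1, e 3] = -α ![e 0, e 2]
  h₁₂ : α ![e 1, e 2] = α ![e 0, e 3]

theorem IsSelfDualIn.sum {ι : Type*} [Fintype ι] {e : Fin 4 → V}
    {ω : ι → V [⋀^Fin 2]→L[ℝ] ℝ} (h : ∀ i, IsSelfDualIn e (ω i)) (c : ι → ℝ) :
    IsSelfDualIn e (∑ i, c i • ω i) := by
  constructor <;> simp [ContinuousAlternatingMap.sum_apply, (h _).h₂₃, (h _).h₁₃, (h _).h₁₂]

theorem IsSelfDualIn.comp_smul {e : Fin 4 → V} {α : V [⋀^Fin 2]→L[ℝ] ℝ} (h : IsSelfDualIn e α)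
    (r : ℝ) : IsSelfDualIn (fun i => r • e i) α := by
  constructor <;> simp [two_smul_left, two_smul_right, h.h₂₃, h.h₁₃, h.h₁₂]

variable [IsTopologicalAddGroup V] [ContinuousSMul ℝ V] [T2Space V] [FiniteDimensional ℝ V]

@[simp]
theorem toContinuousForm_apply {n : ℕ} (f : V [⋀^Fin n]→ₗ[ℝ] ℝ) (v : Fin n → V) :
    toContinuousForm f v = f v := rfl

theorem wedge_comm (α β : V [⋀^Fin 2]→L[ℝ] ℝ) : wedge α β = wedge β α := by
  ext v
  simp only [wedge_apply, wedgeFun]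
  ring

/-- Behaviour of the matrix of wedge products under a linear change of the triple. -/
theorem wedge_matrix (C : Matrix (Fin 3) (Fin 3) ℝ) (ω : Fin 3 → V [⋀^Fin 2]→L[ℝ] ℝ)
    (v : Fin 4 → V) (i j : Fin 3) :
    wedge (∑ k, C i k • ω k) (∑ k, C j k • ω k) v =
      (C * (Matrix.of fun k l => wedge (ω k) (ω l) v) * C.transpose) i j := by
  simp [wedgeFun, Matrix.mul_apply, Fin.sum_univ_three]
  ring

/-- The Hodge star on `2`-forms of the metric and orientation in which `e` is oriented and
orthonormal. -/
def hodge (e : Module.Basis (Fin 4) ℝ V) (α : V [⋀^Fin 2]→L[ℝ] ℝ) : V [⋀^Fin 2]→L[ℝ] ℝ :=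
  toContinuousForm
    ((1 / 2 : ℝ) • ∑ i, ∑ j, α ![e i, e j] • (e.det.curryLeft (e i)).curryLeft (e j))

theorem hodge_apply (e : Module.Basis (Fin 4) ℝ V) (α : V [⋀^Fin 2]→L[ℝ] ℝ) (u v : V) :
    hodge e α ![u, v] = 1 / 2 * ∑ i, ∑ j, α ![e i, e j] * e.det ![e i, e j, u, v] := by
  have hs : ∀ (s : Fin 4 → V [⋀^Fin 2]→ₗ[ℝ] ℝ) (w : Fin 2 → V), (∑ i, s i) w = ∑ i, s i w := by
    intro s w; simp [Fin.sum_univ_four]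
  simp [hodge, hs]

-- Writing the value as an integer determinant makes the sign of an index tuple decidable by
-- evaluation.
omit [TopologicalSpace V] [IsTopologicalAddGroup V] [ContinuousSMul ℝ V] [T2Space V]
  [FiniteDimensional ℝ V] in
theorem det_frame (e : Module.Basis (Fin 4) ℝ V) (i j k l : Fin 4) :
    e.det ![e i, e j, e k, e l] =
      ((Matrix.of fun r c => if ![i, j, k, l] c = r then (1 : ℤ) else 0).det : ℤ) := by
  rw [Module.Basis.det_apply, Int.cast_det]
  congr 1
  ext r c
  have : ![e i, e j, e k, e l] c = e (![i, j, k, l] c) := by fin_cases c <;> rfl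
  simp [Module.Basis.toMatrix_apply, this, Finsupp.single_apply]

/-- The hypothesis encodes that `(i, j, k, l)` is an even permutation of the indices. Only the pairs
`(i, j)` and `(j, i)` then contribute to the double sum, and they contribute equally, which absorbs
the factor `1 / 2`. -/
theorem hodge_frame_aux (e : Module.Basis (Fin 4) ℝ V) (α : V [⋀^Fin 2]→L[ℝ] ℝ)
    {i j k l : Fin 4} (h : ∀ i' j', (Matrix.of fun r c =>
      if ![i', j', k, l] c = r then (1 : ℤ) else 0).det =
        if i' = i ∧ j' = j then 1 else if i' = j ∧ j' = i then -1 else 0) :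
    hodge e α ![e k, e l] = α ![e i, e j] := by
  have h' : ∀ i' j', e.det ![e i', e j', e k, e l] =
      (if i' = i ∧ j' = j then (1 : ℝ) else if i' = j ∧ j' = i then -1 else 0) := by
    intro i' j'
    rw [det_frame, h]
    push_cast
    rfl
  have hij : i ≠ j := by
    rintro rfl
    have h₁ := det_frame e i i k l
    rw [h, AlternatingMap.map_eq_zero_of_eq (i := 0) (j := 1) _ _ rfl (by decide)] at h₁
    simp at h₁
  have hs := two_swap α (e j) (e i)
  have h'' : ∀ i' j', α ![e i', e j'] * e.det ![e i', e j', e k, e l] =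
      (if i' = i ∧ j' = j then α ![e i, e j] else 0) +
        if i' = j ∧ j' = i then α ![e i, e j] else 0 := by
    intro i' j'
    rw [h']
    split_ifs with h₁ h₂ h₃
    · exact absurd (h₁.1.symm.trans h₂.1) hij
    · rw [h₁.1, h₁.2]; ring
    · rw [h₃.1, h₃.2, hs]; ring
    · ring
  rw [hodge_apply]
  simp only [h'', Finset.sum_add_distrib, ite_and, Finset.sum_ite_eq', Finset.mem_univ, if_true,
    Finset.sum_ite_irrel, Finset.sum_const_zero]
  ring

theorem hodge_frame (e : Module.Basis (Fin 4) ℝ V) (α : V [⋀^Fin 2]→L[ℝ] ℝ) :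
    hodge e α ![e 0, e 1] = α ![e 2, e 3] ∧ hodge e α ![e 0, e 2] = -α ![e 1, e 3] ∧
    hodge e α ![e 0, e 3] = α ![e 1, e 2] ∧ hodge e α ![e 1, e 2] = α ![e 0, e 3] ∧
    hodge e α ![e 1, e 3] = -α ![e 0, e 2] ∧ hodge e α ![e 2, e 3] = α ![e 0, e 1] := by
  refine ⟨hodge_frame_aux e α ?_, ?_, hodge_frame_aux e α ?_, hodge_frame_aux e α ?_, ?_,
    hodge_frame_aux e α ?_⟩
  · decide +kernel
  -- The sign is absorbed into `α ![e 3, e 1]`, since `(3, 1, 0, 2)` is the even arrangement.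
  · rw [← two_swap]
    exact hodge_frame_aux e α (by decide +kernel)
  · decide +kernel
  · decide +kernel
  · rw [← two_swap]
    exact hodge_frame_aux e α (by decide +kernel)
  · decide +kernel

theorem hodge_eq_self_iff (e : Module.Basis (Fin 4) ℝ V) (α : V [⋀^Fin 2]→L[ℝ] ℝ) :
    hodge e α = α ↔ IsSelfDualIn e α := by
  obtain ⟨h₀₁, h₀₂, h₀₃, h₁₂, h₁₃, h₂₃⟩ := hodge_frame e α
  constructor
  · intro h
    rw [h] at h₀₁ h₀₂ h₀₃ h₁₂ h₁₃ h₂₃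
    exact ⟨h₂₃, h₁₃, h₁₂⟩
  · rintro ⟨k₁, k₂, k₃⟩
    apply two_ext e <;> linarith

theorem isSelfDualIn_add_hodge (e : Module.Basis (Fin 4) ℝ V) (α : V [⋀^Fin 2]→L[ℝ] ℝ) :
    IsSelfDualIn e ((1 / 2 : ℝ) • (α + hodge e α)) := by
  obtain ⟨h₀₁, h₀₂, h₀₃, h₁₂, h₁₃, h₂₃⟩ := hodge_frame e α
  constructor <;> simp [h₀₁, h₀₂, h₀₃, h₁₂, h₁₃, h₂₃] <;> ring

theorem hodge_smul (e : Module.Basis (Fin 4) ℝ V) (c : ℝ) (α : V [⋀^Fin 2]→L[ℝ] ℝ) :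
    hodge e (c • α) = c • hodge e α := by
  ext v
  have hv : v = ![v 0, v 1] := by funext i; fin_cases i <;> rfl
  rw [hv]
  simp only [hodge_apply, ContinuousAlternatingMap.smul_apply, smul_eq_mul, Finset.mul_sum]
  exact Finset.sum_congr rfl fun i _ => Finset.sum_congr rfl fun j _ => by ring

/-- The wedge product of a self-dual form with an arbitrary form sees only the self-dual part of
the latter. -/
theorem wedge_selfDual (e : Module.Basis (Fin 4) ℝ V) {α : V [⋀^Fin 2]→L[ℝ] ℝ}
    (hα : IsSelfDualIn e α) (β : V [⋀^Fin 2]→L[ℝ] ℝ) :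
    wedge α β = wedge α ((1 / 2 : ℝ) • (β + hodge e β)) := by
  obtain ⟨h₀₁, h₀₂, h₀₃, h₁₂, h₁₃, h₂₃⟩ := hodge_frame e β
  apply four_ext e
  simp only [wedge_apply, wedgeFun, ContinuousAlternatingMap.smul_apply, smul_eq_mul,
    ContinuousAlternatingMap.add_apply, h₀₁, h₀₂, h₀₃, h₁₂, h₁₃, h₂₃, hα.h₂₃, hα.h₁₃, hα.h₁₂]
  ring

omit [TopologicalSpace V] [IsTopologicalAddGroup V] [ContinuousSMul ℝ V] [T2Space V]
  [FiniteDimensional ℝ V] in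
/-- Contraction with an inner product does not depend on the orthonormal basis. -/
theorem sum_mul_eq_of_orthogonal {e f : Fin 4 → V} {P : Matrix (Fin 4) (Fin 4) ℝ}
    (hP : P * P.transpose = 1) (hf : ∀ i, f i = ∑ k, P i k • e k) (φ ψ : V →ₗ[ℝ] ℝ) :
    ∑ i, φ (f i) * ψ (f i) = ∑ k, φ (e k) * ψ (e k) := by
  have hP' : ∀ k l, ∑ i, P i k * P i l = if k = l then 1 else 0 := by
    intro k l
    have h₁ : P.transpose * P = 1 := mul_eq_one_comm.mp hP
    have := congrFun (congrFun h₁ k) l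
    simpa [Matrix.mul_apply, Matrix.one_apply] using this
  calc ∑ i, φ (f i) * ψ (f i)
      = ∑ i, ∑ k, ∑ l, (P i k * P i l) * (φ (e k) * ψ (e l)) := by
        refine Finset.sum_congr rfl fun i _ => ?_
        simp only [hf i, map_sum, map_smul, smul_eq_mul, Finset.sum_mul_sum]
        exact Finset.sum_congr rfl fun k _ => Finset.sum_congr rfl fun l _ => by ring
    _ = ∑ k, ∑ l, (∑ i, P i k * P i l) * (φ (e k) * ψ (e l)) := by
        simp only [Finset.sum_mul]
        rw [Finset.sum_comm]
        exact Finset.sum_congr rfl fun k _ => Finset.sum_comm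
    _ = ∑ k, φ (e k) * ψ (e k) := by simp [hP']

/-- The Hodge star depends only on the orthonormality relations and the volume form. -/
theorem hodge_eq_of_orthogonal (e f : Module.Basis (Fin 4) ℝ V) (P : Matrix (Fin 4) (Fin 4) ℝ)
    (hP : P * P.transpose = 1) (hf : ∀ i, f i = ∑ k, P i k • e k) (hdet : f.det = e.det)
    (α : V [⋀^Fin 2]→L[ℝ] ℝ) : hodge f α = hodge e α := by
  ext v
  have hv : v = ![v 0, v 1] := by funext i; fin_cases i <;> rfl
  rw [hv, hodge_apply, hodge_apply, hdet]
  congr 1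
  -- With equal volume forms, the star is a double contraction of two bilinear forms. Each of the
  -- two sums is independent of the orthonormal basis.
  let F : V →ₗ[ℝ] V →ₗ[ℝ] ℝ := LinearMap.mk₂ ℝ (fun a b => α ![a, b])
    (two_add_left α) (two_smul_left α) (two_add_right α) (two_smul_right α)
  let β : V →ₗ[ℝ] V →ₗ[ℝ] ℝ := LinearMap.mk₂ ℝ (fun a b => e.det ![a, b, v 0, v 1])
    (fun a b c => AlternatingMap.map_vecCons_add _ _ _ _)
    (fun c a b => AlternatingMap.map_vecCons_smul _ _ _ _)
    (fun a b c => (AlternatingMap.map_vecCons_add (e.det.curryLeft a) ![v 0, v 1] b c))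
    (fun c a b => (AlternatingMap.map_vecCons_smul (e.det.curryLeft a) ![v 0, v 1] c b))
  change ∑ i, ∑ j, F (f i) (f j) * β (f i) (f j) = ∑ i, ∑ j, F (e i) (e j) * β (e i) (e j)
  simp only [sum_mul_eq_of_orthogonal hP hf]
  rw [Finset.sum_comm]
  conv_rhs => rw [Finset.sum_comm]
  refine Finset.sum_congr rfl fun j _ => ?_
  exact sum_mul_eq_of_orthogonal hP hf (F.flip (e j)) (β.flip (e j))

end LinearAlgebra

/-! ### A frame in which a positive definite triple is self-dual. -/

section LinearAlgebra

variable {V : Type*} [AddCommGroup V] [Module ℝ V] [TopologicalSpace V]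

/-- If no nontrivial combination of the forms is annihilated by `u`, the functionals
`θ i (u, ·)` admit dual vectors. -/
theorem exists_dual_vectors (θ : Fin 3 → V [⋀^Fin 2]→L[ℝ] ℝ) (u : V)
    (h : ∀ c : Fin 3 → ℝ, (∀ v, ∑ i, c i * θ i ![u, v] = 0) → c = 0) :
    ∃ w : Fin 3 → V, ∀ i j, θ i ![u, w j] = if i = j then 1 else 0 := by
  let L : V →ₗ[ℝ] (Fin 3 → ℝ) :=
    { toFun := fun v i => θ i ![u, v]
      map_add' := fun a b => funext fun i => two_add_right _ _ _ _
      map_smul' := fun c a => funext fun i => two_smul_right _ _ _ _ }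
  have hL : L.range = ⊤ := by
    -- Were `L` not surjective, a nonzero functional on `ℝ³` would vanish on its range; its
    -- coefficients form a combination excluded by `h`.
    by_contra hne
    obtain ⟨f, hf, hk⟩ := Submodule.exists_le_ker_of_lt_top _ (lt_top_iff_ne_top.mpr hne)
    have hfx : ∀ x, f x = ∑ i, f (Pi.single i 1) * x i := by
      intro x
      conv_lhs => rw [pi_eq_sum_univ' x]
      simp [mul_comm]
    have hc := h (fun i => f (Pi.single i 1)) fun v => by
      have : f (L v) = 0 := hk ⟨v, rfl⟩
      rw [hfx] at this
      exact this
    apply hf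
    ext i
    simpa using congrFun hc i
  have hs : ∀ j, ∃ w, L w = fun i => if i = j then (1 : ℝ) else 0 := fun j =>
    LinearMap.range_eq_top.mp hL _
  choose w hw using hs
  exact ⟨w, fun i j => congrFun (hw j) i⟩

variable [IsTopologicalAddGroup V] [ContinuousSMul ℝ V] [T2Space V] [FiniteDimensional ℝ V]

/-- A triple with `θᵢ ∧ θⱼ = δᵢⱼ ν` for a volume form `ν` is self-dual with respect to some basis,
positively oriented for `ν`. -/
theorem exists_selfDual_basis_of_orthonormal (b : Module.Basis (Fin 4) ℝ V)
    (θ : Fin 3 → V [⋀^Fin 2]→L[ℝ] ℝ)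
    (h : ∀ i j, wedge (θ i) (θ j) b = if i = j then 1 else 0) :
    ∃ e : Module.Basis (Fin 4) ℝ V, 0 < b.det e ∧ ∀ j, IsSelfDualIn e (θ j) := by
  set u := b 0 with hu
  obtain ⟨w, hw⟩ := exists_dual_vectors θ u (by
    intro c hc
    -- A form annihilated by `b 0` has square zero, whereas the square of `∑ c i • θ i` on `b` is
    -- the sum of the `c i ^ 2`.
    have h₁ : wedge (∑ i, c i • θ i) (∑ i, c i • θ i) b = 0 := by
      have hz : ∀ v, (∑ i, c i • θ i) ![b 0, v] = 0 := by
        intro v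
        simpa [ContinuousAlternatingMap.sum_apply] using hc v
      simp [wedgeFun, hz]
    have h₂ := wedge_matrix (Matrix.of fun _ : Fin 3 => c) θ b 0 0
    simp only [Matrix.of_apply] at h₂
    rw [h₁] at h₂
    simp only [Matrix.mul_apply, Matrix.of_apply, h, Fin.sum_univ_three, Matrix.transpose_apply] at h₂
    simp at h₂
    have h₃ : c 0 = 0 := by nlinarith [sq_nonneg (c 0), sq_nonneg (c 1), sq_nonneg (c 2)]
    have h₄ : c 1 = 0 := by nlinarith [sq_nonneg (c 0), sq_nonneg (c 1), sq_nonneg (c 2)]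
    have h₅ : c 2 = 0 := by nlinarith [sq_nonneg (c 0), sq_nonneg (c 1), sq_nonneg (c 2)]
    funext i
    fin_cases i <;> assumption)
  -- Adding multiples of `u` keeps the pairings with `u`. The nine values of the `θ i` on pairs of
  -- these vectors satisfy six wedge relations; the three shifts are chosen to kill three of the
  -- values (`z₁`, `z₂`, `z₃` below), and the relations then determine the rest.
  obtain ⟨e₁, he₁⟩ : ∃ x, x = w 0 + (-θ 1 ![w 0, w 1]) • u := ⟨_, rfl⟩
  obtain ⟨e₂, he₂⟩ : ∃ x, x = w 1 + (θ 0 ![w 0, w 1]) • u := ⟨_, rfl⟩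
  obtain ⟨e₃, he₃⟩ : ∃ x, x = w 2 + (θ 0 ![w 0, w 2]) • u := ⟨_, rfl⟩
  have d₁ : ∀ i, θ i ![u, e₁] = if i = 0 then 1 else 0 := fun i => by
    rw [he₁, two_add_right, two_smul_right, two_self, hw]; simp
  have d₂ : ∀ i, θ i ![u, e₂] = if i = 1 then 1 else 0 := fun i => by
    rw [he₂, two_add_right, two_smul_right, two_self, hw]; simp
  have d₃ : ∀ i, θ i ![u, e₃] = if i = 2 then 1 else 0 := fun i => by
    rw [he₃, two_add_right, two_smul_right, two_self, hw]; simp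
  have hw' : ∀ i j, θ i ![w j, u] = -if i = j then 1 else 0 := fun i j => by
    rw [two_swap, hw]
  have z₁ : θ 0 ![e₁, e₂] = 0 := by
    rw [he₁, he₂]
    simp only [two_add_right, two_add_left, two_smul_left, two_smul_right, two_self, hw, hw']
    simp
  have z₂ : θ 0 ![e₁, e₃] = 0 := by
    rw [he₁, he₃]
    simp only [two_add_right, two_add_left, two_smul_left, two_smul_right, two_self, hw, hw']
    simp
  have z₃ : θ 1 ![e₁, e₂] = 0 := by
    rw [he₁, he₂]
    simp only [two_add_right, two_add_left, two_smul_left, two_smul_right, two_self, hw, hw']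
    simp
  have hli : LinearIndependent ℝ ![u, e₁, e₂, e₃] := by
    rw [Fintype.linearIndependent_iff]
    intro g hg
    have hg' : g 0 • u + g 1 • e₁ + g 2 • e₂ + g 3 • e₃ = 0 := by
      simpa [Fin.sum_univ_four] using hg
    have hθ : ∀ i, θ i ![u, g 0 • u + g 1 • e₁ + g 2 • e₂ + g 3 • e₃] = 0 := by
      intro i
      rw [hg', ← zero_smul ℝ u, two_smul_right, zero_mul]
    simp only [two_add_right, two_smul_right, two_self, d₁, d₂, d₃] at hθ
    have g₁ : g 1 = 0 := by simpa using hθ 0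
    have g₂ : g 2 = 0 := by simpa using hθ 1
    have g₃ : g 3 = 0 := by simpa using hθ 2
    have g₀ : g 0 = 0 := by
      rw [g₁, g₂, g₃] at hg'
      simpa [hu, b.ne_zero 0] using hg'
    intro i
    fin_cases i <;> assumption
  have hdim : Fintype.card (Fin 4) = Module.finrank ℝ V := (Module.finrank_eq_card_basis b).symm
  obtain ⟨e, he⟩ : ∃ e : Module.Basis (Fin 4) ℝ V, ⇑e = ![u, e₁, e₂, e₃] :=
    ⟨basisOfLinearIndependentOfCardEqFinrank hli hdim, by simp⟩
  have hm₀ : b.det e ≠ 0 := (b.isUnit_det e).ne_zero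
  have hm : ∀ i j, wedge (θ i) (θ j) ![u, e₁, e₂, e₃] = if i = j then b.det e else 0 := by
    intro i j
    rw [← he, four_apply b, h]
    simp
  simp only [wedge_apply, wedgeFun] at hm
  simp [d₁, d₂, d₃] at hm
  -- The diagonal relations make the remaining nonzero values `±s`. Dividing the last three vectors
  -- by `s` gives both sides of each self-duality equation absolute value `1 / |s|`. The sign of `s`
  -- is not needed.
  obtain ⟨s, hs⟩ : ∃ s, s = b.det e / 2 := ⟨_, rfl⟩
  have hs₀ : s ≠ 0 := by rw [hs]; exact div_ne_zero hm₀ two_ne_zero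
  have m₀₀ := hm 0 0
  have m₁₁ := hm 1 1
  have m₂₂ := hm 2 2
  have m₀₁ := hm 0 1
  have m₀₂ := hm 0 2
  have m₁₂ := hm 1 2
  simp at m₀₀ m₁₁ m₂₂ m₀₁ m₀₂ m₁₂
  let c : Fin 4 → ℝˣ := ![1, (Units.mk0 s hs₀)⁻¹, (Units.mk0 s hs₀)⁻¹, (Units.mk0 s hs₀)⁻¹]
  let f := e.unitsSMul c
  have f₀ : f 0 = u := by simp [f, c, Module.Basis.unitsSMul_apply, he]
  have f₁ : f 1 = s⁻¹ • e₁ := by simp [f, c, Module.Basis.unitsSMul_apply, he, Units.smul_def]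
  have f₂ : f 2 = s⁻¹ • e₂ := by simp [f, c, Module.Basis.unitsSMul_apply, he, Units.smul_def]
  have f₃ : f 3 = s⁻¹ • e₃ := by simp [f, c, Module.Basis.unitsSMul_apply, he, Units.smul_def]
  have hsd : ∀ j, IsSelfDualIn f (θ j) := by
    intro j
    constructor <;>
      simp only [f₀, f₁, f₂, f₃, two_smul_left, two_smul_right, d₁, d₂, d₃] <;>
      field_simp <;> fin_cases j <;> simp <;> linarith
  refine ⟨f, ?_, hsd⟩
  -- The orientation is automatic: `b.det f` is the square of the self-dual form `θ 0` on `f`, a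
  -- positive multiple of a sum of squares.
  have hf := four_apply b (wedge (θ 0) (θ 0)) f
  rw [h, if_pos rfl, one_mul] at hf
  rw [← hf, wedge_apply, wedgeFun, (hsd 0).h₂₃, (hsd 0).h₁₃, (hsd 0).h₁₂, f₀, f₁, f₂, f₃]
  simp only [two_smul_right, d₁, d₂, d₃]
  simp
  positivity

-- A nonnegative element of a C*-algebra has the form `star B * B`; definiteness makes the factor
-- invertible.
open scoped MatrixOrder Matrix.Norms.L2Operator in
theorem exists_factor {n : Type*} [Fintype n] [DecidableEq n] {q : Matrix n n ℝ} (hq : q.PosDef) :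
    ∃ A : Matrix n n ℝ, IsUnit A ∧ q = A * A.transpose := by
  obtain ⟨B, hB⟩ := CStarAlgebra.nonneg_iff_eq_star_mul_self.mp hq.posSemidef.nonneg
  have hB' : q = B.transpose * B.transpose.transpose := by
    rw [hB, Matrix.star_eq_conjTranspose, Matrix.conjTranspose_eq_transpose_of_trivial,
      Matrix.transpose_transpose]
  refine ⟨B.transpose, ?_, hB'⟩
  have h := hq.isUnit
  rw [hB', Matrix.isUnit_iff_isUnit_det, Matrix.det_mul] at h
  rw [Matrix.isUnit_iff_isUnit_det]
  exact isUnit_of_mul_isUnit_left h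

/-- A triple with positive definite matrix of wedge products is self-dual with respect to a
positively oriented basis, on which moreover the trace of that matrix is `1`. -/
theorem exists_selfDual_basis (b : Module.Basis (Fin 4) ℝ V)
    (ω : Fin 3 → V [⋀^Fin 2]→L[ℝ] ℝ)
    (hq : (Matrix.of fun i j => wedge (ω i) (ω j) b).PosDef) :
    ∃ e : Module.Basis (Fin 4) ℝ V, 0 < b.det e ∧ (∀ j, IsSelfDualIn e (ω j)) ∧
      (∑ i, wedge (ω i) (ω i)) e = 1 := by
  obtain ⟨A, hA, hAq⟩ := exists_factor hq
  have hdet := (Matrix.isUnit_iff_isUnit_det A).mp hA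
  obtain ⟨e, he, hsd⟩ := exists_selfDual_basis_of_orthonormal b (fun i => ∑ k, A⁻¹ i k • ω k) (by
    intro i j
    rw [wedge_matrix, hAq, Matrix.mul_assoc, Matrix.mul_assoc, ← Matrix.transpose_mul,
      Matrix.nonsing_inv_mul A hdet, Matrix.transpose_one, Matrix.mul_one,
      Matrix.nonsing_inv_mul A hdet, Matrix.one_apply])
  have hω : ∀ j, ω j = ∑ i, A j i • ∑ k, A⁻¹ i k • ω k := by
    intro j
    have h₁ : ∀ k, ∑ i, A j i * A⁻¹ i k = if j = k then 1 else 0 := fun k => by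
      rw [← Matrix.mul_apply, Matrix.mul_nonsing_inv A hdet, Matrix.one_apply]
    simp only [Finset.smul_sum, smul_smul]
    rw [Finset.sum_comm]
    simp [← Finset.sum_smul, h₁]
  have hsd' : ∀ j, IsSelfDualIn e (ω j) := fun j => by
    rw [hω j]
    exact IsSelfDualIn.sum hsd _
  have htr : 0 < (∑ i, wedge (ω i) (ω i)) b := by
    have := hq.trace_pos
    simpa [Matrix.trace, ContinuousAlternatingMap.sum_apply] using this
  obtain ⟨m, hm⟩ : ∃ m, m = (∑ i, wedge (ω i) (ω i)) e := ⟨_, rfl⟩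
  have hm₀ : 0 < m := by
    rw [hm, four_apply b]
    exact mul_pos htr he
  -- Scaling a frame by `r` multiplies 4-forms by `r ^ 4`, hence the fourth root.
  obtain ⟨r, hr⟩ : ∃ r : ℝ, r = (√√m)⁻¹ := ⟨_, rfl⟩
  have hr₀ : 0 < r := by rw [hr]; positivity
  have hr₄ : r ^ 4 * m = 1 := by
    have h₁ : (√√m) ^ 4 = m := by
      rw [show 4 = 2 * 2 from rfl, pow_mul, Real.sq_sqrt (Real.sqrt_nonneg _),
        Real.sq_sqrt hm₀.le]
    rw [hr, inv_pow, h₁, inv_mul_cancel₀ hm₀.ne']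
  let f := e.unitsSMul fun _ => Units.mk0 r hr₀.ne'
  have hf : ⇑f = fun i => r • e i := by
    funext i
    simp [f, Module.Basis.unitsSMul_apply, Units.smul_def]
  have hscale : ∀ η : V [⋀^Fin 4]→L[ℝ] ℝ, η f = r ^ 4 * η e := by
    intro η
    rw [hf]
    have := η.toMultilinearMap.map_smul_univ (fun _ => r) e
    simpa using this
  refine ⟨f, ?_, fun j => ?_, ?_⟩
  · have := hscale (toContinuousForm b.det)
    simp only [toContinuousForm_apply] at this
    rw [this]
    positivity
  · rw [hf]
    exact (hsd' j).comp_smul r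
  · rw [hscale, ← hm, hr₄]

/-- The `2`-form `ι_u α ∧ ι_v β`. -/
def contraction (α β : V [⋀^Fin 2]→L[ℝ] ℝ) (u v : V) : V [⋀^Fin 2]→L[ℝ] ℝ :=
  toContinuousForm
    { toFun := fun w => α ![u, w 0] * β ![v, w 1] - α ![u, w 1] * β ![v, w 0]
      map_update_add' := by
        intro inst w i x y
        have h : inst = instDecidableEqFin 2 := Subsingleton.elim _ _
        subst h
        fin_cases i <;> simp [Function.update, two_add_right] <;> ring
      map_update_smul' := by
        intro inst w i c x
        have h : inst = instDecidableEqFin 2 := Subsingleton.elim _ _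
        subst h
        fin_cases i <;> simp [Function.update, two_smul_right] <;> ring
      map_eq_zero_of_eq' := by
        intro w i j h hij
        fin_cases i <;> fin_cases j <;> first | exact absurd rfl hij | skip
        all_goals
          simp only [Fin.zero_eta, Fin.mk_one] at h
          rw [h]
          ring }

theorem contraction_apply (α β : V [⋀^Fin 2]→L[ℝ] ℝ) (u v a b : V) :
    contraction α β u v ![a, b] = α ![u, a] * β ![v, b] - α ![u, b] * β ![v, a] := rfl

/-- The `4`-form `ι_u ω₁ ∧ ι_v ω₂ ∧ ω₃ + ι_v ω₁ ∧ ι_u ω₂ ∧ ω₃`, which determines the conformal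
class of the metric of a triple. -/
def metricForm (ω : Fin 3 → V [⋀^Fin 2]→L[ℝ] ℝ) (u v : V) : V [⋀^Fin 4]→L[ℝ] ℝ :=
  wedge (contraction (ω 0) (ω 1) u v) (ω 2) + wedge (contraction (ω 0) (ω 1) v u) (ω 2)

end LinearAlgebra

/-! ### The inner product of a frame and its recovery from the triple. -/

section LinearAlgebra

variable {V : Type*} [AddCommGroup V] [Module ℝ V] [TopologicalSpace V]
variable [IsTopologicalAddGroup V] [ContinuousSMul ℝ V] [T2Space V] [FiniteDimensional ℝ V]

/-- The inner product for which the basis `e` is orthonormal. -/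
def frameInner (e : Module.Basis (Fin 4) ℝ V) : V →L[ℝ] V →L[ℝ] ℝ :=
  ∑ i, (LinearMap.toContinuousLinearMap (e.coord i)).smulRight
    (LinearMap.toContinuousLinearMap (e.coord i))

theorem frameInner_apply (e : Module.Basis (Fin 4) ℝ V) (u v : V) :
    frameInner e u v = ∑ i, e.repr u i * e.repr v i := by
  simp [frameInner]

theorem frameInner_frame (e : Module.Basis (Fin 4) ℝ V) (i j : Fin 4) :
    frameInner e (e i) (e j) = if i = j then 1 else 0 := by
  simp [frameInner_apply, Finsupp.single_apply]

theorem frameInner_comm (e : Module.Basis (Fin 4) ℝ V) (u v : V) :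
    frameInner e u v = frameInner e v u := by
  simp only [frameInner_apply, mul_comm]

theorem frameInner_pos (e : Module.Basis (Fin 4) ℝ V) {v : V} (hv : v ≠ 0) :
    0 < frameInner e v v := by
  rw [frameInner_apply]
  refine lt_of_le_of_ne (Finset.sum_nonneg fun i _ => mul_self_nonneg _) fun h => hv ?_
  have h' := (Finset.sum_eq_zero_iff_of_nonneg fun i _ => mul_self_nonneg (e.repr v i)).mp h.symm
  apply e.repr.map_eq_zero_iff.mp
  ext i
  simpa using h' i (Finset.mem_univ i)

theorem frameInner_isVonNBounded (e : Module.Basis (Fin 4) ℝ V) :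
    Bornology.IsVonNBounded ℝ {v : V | frameInner e v v < 1} := by
  have hb : Bornology.IsVonNBounded ℝ (Metric.ball (0 : Fin 4 → ℝ) 2) :=
    NormedSpace.isVonNBounded_ball ℝ _ _
  refine (hb.image (LinearMap.toContinuousLinearMap e.equivFun.symm.toLinearMap)).subset ?_
  intro v hv
  refine ⟨e.equivFun v, ?_, by simp⟩
  rw [mem_ball_zero_iff]
  refine lt_of_le_of_lt ((pi_norm_le_iff_of_nonneg zero_le_one).mpr fun i => ?_) one_lt_two
  rw [Set.mem_ofPred_eq, frameInner_apply] at hv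
  have h₁ := Finset.single_le_sum (f := fun i => e.repr v i * e.repr v i)
    (fun i _ => mul_self_nonneg _) (Finset.mem_univ i)
  rw [Real.norm_eq_abs, Module.Basis.equivFun_apply, ← abs_one, ← sq_le_sq]
  nlinarith

theorem eq_frameInner {e : Module.Basis (Fin 4) ℝ V} {g : V →L[ℝ] V →L[ℝ] ℝ}
    (h : ∀ i j, g (e i) (e j) = if i = j then 1 else 0) : g = frameInner e := by
  have h₁ : g.toLinearMap = (frameInner e).toLinearMap := e.ext fun i => by
    have h₂ : (g (e i)).toLinearMap = (frameInner e (e i)).toLinearMap := e.ext fun j => by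
      simp [h, frameInner_frame]
    exact ContinuousLinearMap.coe_injective h₂
  exact ContinuousLinearMap.coe_injective h₁

/-- Two orthonormal bases with the same orientation define the same volume form and Hodge star. -/
theorem det_and_hodge_eq {e f : Module.Basis (Fin 4) ℝ V} (ho : e.orientation = f.orientation)
    (h : ∀ i j, frameInner e (f i) (f j) = if i = j then 1 else 0) :
    f.det = e.det ∧ ∀ α, hodge f α = hodge e α := by
  let P : Matrix (Fin 4) (Fin 4) ℝ := Matrix.of fun i k => e.repr (f i) k
  have hP : P * P.transpose = 1 := by
    ext i j
    simp only [P, Matrix.mul_apply, Matrix.of_apply, Matrix.transpose_apply, Matrix.one_apply,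
      ← frameInner_apply, h]
  have hd : e.det f = P.det := by
    rw [Module.Basis.det_apply, ← Matrix.det_transpose]
    rfl
  have hpos := (e.orientation_eq_iff_det_pos f).mp ho
  have hsq : P.det * P.det = 1 := by
    have := congrArg Matrix.det hP
    rwa [Matrix.det_mul, Matrix.det_transpose, Matrix.det_one] at this
  -- Orthogonality gives determinant `±1`; the common orientation selects `1`.
  have h1 : e.det f = 1 := by rw [hd] at hpos ⊢; nlinarith
  have hdet : f.det = e.det := by
    conv_rhs => rw [e.det.eq_smul_basis_det f, h1, one_smul]
  exact ⟨hdet, hodge_eq_of_orthogonal e f P hP (fun i => (e.sum_repr (f i)).symm) hdet⟩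

/-- The matrix of wedge products of a triple, evaluated on a frame. -/
def wedgeMatrix (ω : Fin 3 → V [⋀^Fin 2]→L[ℝ] ℝ) (v : Fin 4 → V) : Matrix (Fin 3) (Fin 3) ℝ :=
  Matrix.of fun i j => wedge (ω i) (ω j) v

/-- The matrix of a self-dual triple in the standard basis of self-dual forms of a frame. -/
def coordMatrix (ω : Fin 3 → V [⋀^Fin 2]→L[ℝ] ℝ) (e : Fin 4 → V) : Matrix (Fin 3) (Fin 3) ℝ :=
  Matrix.of fun j k => ω j ![e 0, e k.succ]

/-- The standard self-dual forms of a frame have wedge matrix `2 • 1`, so the wedge matrix here is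
`2 C Cᵀ` with `C` the coordinate matrix. -/
theorem det_wedgeMatrix_frame {ω : Fin 3 → V [⋀^Fin 2]→L[ℝ] ℝ} {e : Fin 4 → V}
    (hsd : ∀ j, IsSelfDualIn e (ω j)) :
    (wedgeMatrix ω e).det = 8 * (coordMatrix ω e).det ^ 2 := by
  simp only [wedgeMatrix, coordMatrix, Matrix.det_fin_three, Matrix.of_apply, wedge_apply, wedgeFun,
    (hsd _).h₂₃, (hsd _).h₁₃, (hsd _).h₁₂, Fin.succ_zero_eq_one, Fin.succ_one_eq_two,
    show Fin.succ (2 : Fin 3) = 3 from rfl]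
  ring

theorem wedgeMatrix_apply_eq (ω : Fin 3 → V [⋀^Fin 2]→L[ℝ] ℝ) (e : Module.Basis (Fin 4) ℝ V)
    (v : Fin 4 → V) : wedgeMatrix ω v = e.det v • wedgeMatrix ω e := by
  ext i j
  simp only [wedgeMatrix, Matrix.of_apply, Matrix.smul_apply, smul_eq_mul]
  rw [four_apply e, mul_comm]

/-- The key identity: a 4-form built from `ω` alone sees the inner product up to scale. Self-duality
reduces all coefficients to the values `ω i ![e 0, e k]`, after which it is a polynomial identity.
-/
theorem metricForm_frame {ω : Fin 3 → V [⋀^Fin 2]→L[ℝ] ℝ} {e : Module.Basis (Fin 4) ℝ V}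
    (hsd : ∀ j, IsSelfDualIn e (ω j)) (u v : V) :
    metricForm ω u v e = 2 * (coordMatrix ω e).det * frameInner e u v := by
  have hu : ∀ (w : V) (i : Fin 3) (k : Fin 4),
      ω i ![w, e k] = ∑ l, e.repr w l * ω i ![e l, e k] := by
    intro w i k
    let F : V →ₗ[ℝ] ℝ := { toFun := fun w => ω i ![w, e k]
                           map_add' := fun a b => two_add_left _ _ _ _
                           map_smul' := fun c a => two_smul_left _ _ _ _ }
    change F w = ∑ l, e.repr w l * F (e l)
    conv_lhs => rw [← e.sum_repr w]
    simp only [map_sum, map_smul, smul_eq_mul]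
  have s₁ : ∀ i, ω i ![e 1, e 0] = -ω i ![e 0, e 1] := fun i => two_swap _ _ _
  have s₂ : ∀ i, ω i ![e 2, e 0] = -ω i ![e 0, e 2] := fun i => two_swap _ _ _
  have s₃ : ∀ i, ω i ![e 3, e 0] = -ω i ![e 0, e 3] := fun i => two_swap _ _ _
  have s₄ : ∀ i, ω i ![e 2, e 1] = -ω i ![e 0, e 3] := fun i => by
    rw [two_swap, (hsd i).h₁₂]
  have s₅ : ∀ i, ω i ![e 3, e 1] = ω i ![e 0, e 2] := fun i => by
    rw [two_swap, (hsd i).h₁₃, neg_neg]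
  have s₆ : ∀ i, ω i ![e 3, e 2] = -ω i ![e 0, e 1] := fun i => by
    rw [two_swap, (hsd i).h₂₃]
  simp only [metricForm, ContinuousAlternatingMap.add_apply, wedge_apply, wedgeFun,
    contraction_apply, hu u, hu v, Fin.sum_univ_four, two_self, s₁, s₂, s₃, s₄, s₅, s₆,
    (hsd _).h₂₃, (hsd _).h₁₃, (hsd _).h₁₂, frameInner_apply, coordMatrix, Matrix.det_fin_three,
    Matrix.of_apply, Fin.succ_zero_eq_one, Fin.succ_one_eq_two,
    show Fin.succ (2 : Fin 3) = 3 from rfl]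
  ring

theorem metricForm_eq {ω : Fin 3 → V [⋀^Fin 2]→L[ℝ] ℝ} {e : Module.Basis (Fin 4) ℝ V}
    (hsd : ∀ j, IsSelfDualIn e (ω j)) (u v : V) (ε : Fin 4 → V) :
    metricForm ω u v ε = 2 * (coordMatrix ω e).det * e.det ε * frameInner e u v := by
  rw [four_apply e, metricForm_frame hsd]
  ring

theorem det_wedgeMatrix {ω : Fin 3 → V [⋀^Fin 2]→L[ℝ] ℝ} {e : Module.Basis (Fin 4) ℝ V}
    (hsd : ∀ j, IsSelfDualIn e (ω j)) (ε : Fin 4 → V) :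
    (wedgeMatrix ω ε).det = 8 * (coordMatrix ω e).det ^ 2 * e.det ε ^ 3 := by
  rw [wedgeMatrix_apply_eq ω e, Matrix.det_smul, det_wedgeMatrix_frame hsd, Fintype.card_fin]
  ring

/-- The inner product determined by a triple is unique. -/
theorem frameInner_unique {ω : Fin 3 → V [⋀^Fin 2]→L[ℝ] ℝ} {e f : Module.Basis (Fin 4) ℝ V}
    (he : ∀ j, IsSelfDualIn e (ω j)) (hf : ∀ j, IsSelfDualIn f (ω j))
    (hdet : f.det e = 1) (hD : (coordMatrix ω e).det ≠ 0) :
    frameInner e = frameInner f := by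
  have h₁ := fun u v => metricForm_frame he u v
  have h₂ := fun u v => metricForm_eq hf u v e
  have h₃ := det_wedgeMatrix_frame he
  have h₄ := det_wedgeMatrix hf e
  rw [hdet] at h₂ h₄
  simp only [one_pow, mul_one] at h₂ h₄
  have hpos := frameInner_pos f (e.ne_zero 0)
  have h₅ := (h₁ (e 0) (e 0)).symm.trans (h₂ (e 0) (e 0))
  rw [frameInner_frame, if_pos rfl] at h₅
  have hsq : (coordMatrix ω e).det ^ 2 = (coordMatrix ω f).det ^ 2 := by linarith
  -- Opposite signs would make one positive definite form a negative multiple of the other, as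
  -- testing on `e 0` shows.
  have hDD : (coordMatrix ω e).det = (coordMatrix ω f).det := by
    rcases sq_eq_sq_iff_eq_or_eq_neg.mp hsq with h | h
    · exact h
    · exfalso
      have h₆ : (coordMatrix ω e).det * (1 + frameInner f (e 0) (e 0)) = 0 := by
        have : (coordMatrix ω f).det = -(coordMatrix ω e).det := by linarith
        rw [this] at h₅
        linarith
      rcases mul_eq_zero.mp h₆ with h | h
      · exact hD h
      · linarith
  ext u v
  have h₆ := (h₁ u v).symm.trans (h₂ u v)
  rw [← hDD] at h₆
  exact mul_left_cancel₀ (mul_ne_zero two_ne_zero hD) h₆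

/-- The inner product determined by a triple, expressed in an arbitrary frame. -/
theorem frameInner_eq_formula {ω : Fin 3 → V [⋀^Fin 2]→L[ℝ] ℝ} {e : Module.Basis (Fin 4) ℝ V}
    (hsd : ∀ j, IsSelfDualIn e (ω j)) (htr : (∑ i, wedge (ω i) (ω i)) e = 1)
    (hD : (coordMatrix ω e).det ≠ 0) {ε : Fin 4 → V} (hε : e.det ε ≠ 0) {z : V} (hz : z ≠ 0) :
    0 < (wedgeMatrix ω ε).det / (2 * (wedgeMatrix ω ε).trace) * metricForm ω z z ε ^ 2 ∧
    ∀ u v, frameInner e u v = metricForm ω u v ε * metricForm ω z z ε /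
      √((wedgeMatrix ω ε).det / (2 * (wedgeMatrix ω ε).trace) * metricForm ω z z ε ^ 2) := by
  have ht : (wedgeMatrix ω ε).trace = e.det ε := by
    have h : (wedgeMatrix ω e).trace = 1 := by
      rw [← htr]
      simp [wedgeMatrix, Matrix.trace, ContinuousAlternatingMap.sum_apply]
    rw [wedgeMatrix_apply_eq ω e, Matrix.trace_smul, h, smul_eq_mul, mul_one]
  have hzz := frameInner_pos e hz
  -- With `D` the coordinate determinant and `δ = e.det ε`, the trace is `δ` and the determinant `8
  -- D² δ³`, so the quotient is `(2Dδ)²`. The auxiliary factor `metricForm ω z z ε` removes the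
  -- unknown sign of `2Dδ`.
  have hK : (wedgeMatrix ω ε).det / (2 * (wedgeMatrix ω ε).trace) * metricForm ω z z ε ^ 2 =
      ((2 * (coordMatrix ω e).det * e.det ε) ^ 2 * frameInner e z z) ^ 2 := by
    rw [ht, det_wedgeMatrix hsd, metricForm_eq hsd]
    field_simp
    ring
  have hK₀ : 0 < (2 * (coordMatrix ω e).det * e.det ε) ^ 2 * frameInner e z z := by positivity
  rw [hK]
  refine ⟨by positivity, fun u v => ?_⟩
  rw [Real.sqrt_sq hK₀.le, metricForm_eq hsd, metricForm_eq hsd, eq_div_iff hK₀.ne']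
  ring

omit [IsTopologicalAddGroup V] [ContinuousSMul ℝ V] [T2Space V] [FiniteDimensional ℝ V] in
/-- The self-dual forms of a frame are spanned by any nondegenerate self-dual triple. -/
theorem isSelfDualIn_iff_mem_span {ω : Fin 3 → V [⋀^Fin 2]→L[ℝ] ℝ} {e : Module.Basis (Fin 4) ℝ V}
    (hsd : ∀ j, IsSelfDualIn e (ω j)) (hD : (coordMatrix ω e).det ≠ 0)
    (α : V [⋀^Fin 2]→L[ℝ] ℝ) :
    IsSelfDualIn e α ↔ α ∈ Submodule.span ℝ (Set.range ω) := by
  rw [Submodule.mem_span_range_iff_exists_fun]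
  constructor
  · intro h
    let t : Fin 3 → ℝ := fun k => α ![e 0, e k.succ]
    let c := Matrix.vecMul t (coordMatrix ω e)⁻¹
    have hc : Matrix.vecMul c (coordMatrix ω e) = t := by
      rw [Matrix.vecMul_vecMul, Matrix.nonsing_inv_mul _ (isUnit_iff_ne_zero.mpr hD),
        Matrix.vecMul_one]
    have hk : ∀ k : Fin 3, ∑ i, c i * ω i ![e 0, e k.succ] = α ![e 0, e k.succ] :=
      fun k => congrFun hc k
    have hs := IsSelfDualIn.sum hsd c
    have hk' : ∀ k : Fin 3, (∑ i, c i • ω i) ![e 0, e k.succ] = α ![e 0, e k.succ] := by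
      intro k
      rw [← hk k]
      simp [ContinuousAlternatingMap.sum_apply]
    -- For self-dual forms the three values on `e 0` and `e k` determine the other three.
    have h₁ := hk' 0
    have h₂ := hk' 1
    have h₃ := hk' 2
    refine ⟨c, two_ext e h₁ h₂ h₃ ?_ ?_ ?_⟩
    · rw [hs.h₁₂, h.h₁₂]; exact h₃
    · rw [hs.h₁₃, h.h₁₃]; exact congrArg _ h₂
    · rw [hs.h₂₃, h.h₂₃]; exact h₁
  · rintro ⟨c, rfl⟩
    exact IsSelfDualIn.sum hsd c

end LinearAlgebra

/-! ### Smoothness of the expressions entering the metric formula. -/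

section SmoothCoefficients

variable {E : Type*} [NormedAddCommGroup E] [NormedSpace ℝ E] [FiniteDimensional ℝ E]
  {s : Set E}

/-- Coefficientwise smoothness on `s` of a field of `2`-forms on a vector space. -/
def SmoothCoeffs (s : Set E) (α : E → E [⋀^Fin 2]→L[ℝ] ℝ) : Prop :=
  ∀ u v : E, ContDiffOn ℝ (⊤ : ℕ∞) (fun y => α y ![u, v]) s

theorem SmoothCoeffs.wedge {α β : E → E [⋀^Fin 2]→L[ℝ] ℝ} (hα : SmoothCoeffs s α)
    (hβ : SmoothCoeffs s β) (v : Fin 4 → E) :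
    ContDiffOn ℝ (⊤ : ℕ∞) (fun y => HKTriple.wedge (α y) (β y) v) s := by
  have h : ∀ a b c d : E, ContDiffOn ℝ (⊤ : ℕ∞) (fun y => α y ![a, b] * β y ![c, d]) s :=
    fun a b c d => (hα a b).mul (hβ c d)
  simp only [wedge_apply, wedgeFun]
  exact (((((h _ _ _ _).sub (h _ _ _ _)).add (h _ _ _ _)).add (h _ _ _ _)).sub
    (h _ _ _ _)).add (h _ _ _ _)

theorem SmoothCoeffs.contraction {α β : E → E [⋀^Fin 2]→L[ℝ] ℝ} (hα : SmoothCoeffs s α)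
    (hβ : SmoothCoeffs s β) (u v : E) :
    SmoothCoeffs s fun y => HKTriple.contraction (α y) (β y) u v := by
  intro a b
  simp only [contraction_apply]
  exact ((hα _ _).mul (hβ _ _)).sub ((hα _ _).mul (hβ _ _))

theorem contDiffOn_metricForm {ω : Fin 3 → E → E [⋀^Fin 2]→L[ℝ] ℝ}
    (h : ∀ j, SmoothCoeffs s (ω j)) (u v : E) (ε : Fin 4 → E) :
    ContDiffOn ℝ (⊤ : ℕ∞) (fun y => metricForm (fun j => ω j y) u v ε) s := by
  simp only [metricForm, ContinuousAlternatingMap.add_apply]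
  exact (((h 0).contraction (h 1) u v).wedge (h 2) ε).add
    (((h 0).contraction (h 1) v u).wedge (h 2) ε)

theorem contDiffOn_det_wedgeMatrix {ω : Fin 3 → E → E [⋀^Fin 2]→L[ℝ] ℝ}
    (h : ∀ j, SmoothCoeffs s (ω j)) (ε : Fin 4 → E) :
    ContDiffOn ℝ (⊤ : ℕ∞) (fun y => (wedgeMatrix (fun j => ω j y) ε).det) s := by
  simp only [wedgeMatrix, Matrix.det_fin_three, Matrix.of_apply]
  have h₃ : ∀ a b c d e f, ContDiffOn ℝ (⊤ : ℕ∞) (fun y => HKTriple.wedge (ω a y) (ω b y) ε *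
      HKTriple.wedge (ω c y) (ω d y) ε * HKTriple.wedge (ω e y) (ω f y) ε) s :=
    fun a b c d e f => (((h a).wedge (h b) ε).mul ((h c).wedge (h d) ε)).mul ((h e).wedge (h f) ε)
  exact (((((h₃ _ _ _ _ _ _).sub (h₃ _ _ _ _ _ _)).sub (h₃ _ _ _ _ _ _)).add
    (h₃ _ _ _ _ _ _)).add (h₃ _ _ _ _ _ _)).sub (h₃ _ _ _ _ _ _)

theorem contDiffOn_trace_wedgeMatrix {ω : Fin 3 → E → E [⋀^Fin 2]→L[ℝ] ℝ}
    (h : ∀ j, SmoothCoeffs s (ω j)) (ε : Fin 4 → E) :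
    ContDiffOn ℝ (⊤ : ℕ∞) (fun y => (wedgeMatrix (fun j => ω j y) ε).trace) s := by
  simp only [wedgeMatrix, Matrix.trace_fin_three, Matrix.of_apply]
  exact (((h 0).wedge (h 0) ε).add ((h 1).wedge (h 1) ε)).add ((h 2).wedge (h 2) ε)

end SmoothCoefficients

/-! ### Forms and bilinear forms in charts. -/

section Manifold

variable {M : Type*} [TopologicalSpace M] [ChartedSpace E4 M]

theorem localRep_apply_two (α : FormField M 2) (x₀ : M) (y a b : E4) :
    localRep α x₀ y ![a, b] =
      α ((extChartAt (𝓡 4) x₀).symm y) ![chartSymmDeriv x₀ y a, chartSymmDeriv x₀ y b] := by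
  simp only [localRep, ContinuousAlternatingMap.compContinuousLinearMap_apply]
  congr 1
  funext i
  fin_cases i <;> rfl

theorem IsSmoothForm.smoothCoeffs {α : FormField M 2} (h : IsSmoothForm α) (x₀ : M) :
    SmoothCoeffs (extChartAt (𝓡 4) x₀).target (localRep α x₀) := by
  intro u v
  let ev : (E4 [⋀^Fin 2]→L[ℝ] ℝ) →L[ℝ] ℝ := ContinuousAlternatingMap.apply ℝ E4 ℝ ![u, v]
  exact ev.contDiff.comp_contDiffOn (h x₀)

theorem wedgeMatrix_localRep (ω : Triple M 2) (x₀ : M) (y : E4) (ε : Fin 4 → E4) :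
    wedgeMatrix (fun j => localRep (ω j) x₀ y) ε =
      wedgeMatrix (fun j => ω j ((extChartAt (𝓡 4) x₀).symm y))
        (fun i => chartSymmDeriv x₀ y (ε i)) := by
  ext i j
  simp only [wedgeMatrix, Matrix.of_apply, wedge_apply, wedgeFun, localRep_apply_two]

theorem metricForm_localRep (ω : Triple M 2) (x₀ : M) (y u v : E4) (ε : Fin 4 → E4) :
    metricForm (fun j => localRep (ω j) x₀ y) u v ε =
      metricForm (fun j => ω j ((extChartAt (𝓡 4) x₀).symm y))
        (chartSymmDeriv x₀ y u) (chartSymmDeriv x₀ y v) (fun i => chartSymmDeriv x₀ y (ε i)) := by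
  simp only [metricForm, ContinuousAlternatingMap.add_apply, wedge_apply, wedgeFun,
    contraction_apply, localRep_apply_two]

variable [IsManifold (𝓡 4) (⊤ : ℕ∞) M]

theorem isManifold_one : IsManifold (𝓡 4) 1 M :=
  IsManifold.of_le (n := ((⊤ : ℕ∞) : WithTop ℕ∞)) (by exact_mod_cast le_top)

theorem chartSymmDeriv_isInvertible (x₀ : M) {y : E4} (hy : y ∈ (extChartAt (𝓡 4) x₀).target) :
    (chartSymmDeriv x₀ y).IsInvertible := by
  have := isManifold_one (M := M)
  have h := isInvertible_mfderivWithin_extChartAt_symm (I := 𝓡 4) hy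
  rw [ModelWithCorners.Boundaryless.range_eq_univ, mfderivWithin_univ] at h
  exact h

/-- A field of bilinear forms on the tangent spaces is smooth if its coefficients in charts are. -/
theorem contMDiff_bilinear (B : ∀ x : M, Tan x →L[ℝ] Tan x →L[ℝ] ℝ)
    (h : ∀ (x₀ : M) (a b : E4), ContDiffOn ℝ (⊤ : ℕ∞) (fun y =>
      B ((extChartAt (𝓡 4) x₀).symm y) (chartSymmDeriv x₀ y a) (chartSymmDeriv x₀ y b))
        (extChartAt (𝓡 4) x₀).target) :
    ContMDiff (𝓡 4) ((𝓡 4).prod 𝓘(ℝ, E4 →L[ℝ] E4 →L[ℝ] ℝ)) (⊤ : ℕ∞)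
      (fun x => Bundle.TotalSpace.mk' (E4 →L[ℝ] E4 →L[ℝ] ℝ)
        (E := fun x : M => Tan x →L[ℝ] Tan x →L[ℝ] ℝ) x (B x)) := by
  have := isManifold_one (M := M)
  intro x₀
  rw [Bundle.contMDiffAt_section]
  let F : E4 → (E4 →L[ℝ] E4 →L[ℝ] ℝ) := fun y =>
    (ContinuousLinearMap.precomp ℝ (chartSymmDeriv x₀ y)).comp
      ((B ((extChartAt (𝓡 4) x₀).symm y)).comp (chartSymmDeriv x₀ y))
  have hF : ContDiffOn ℝ (⊤ : ℕ∞) F (extChartAt (𝓡 4) x₀).target :=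
    contDiffOn_clm_apply.mpr fun a => contDiffOn_clm_apply.mpr fun b => h x₀ a b
  have hFφ : ContMDiffAt (𝓡 4) 𝓘(ℝ, E4 →L[ℝ] E4 →L[ℝ] ℝ) (⊤ : ℕ∞)
      (F ∘ extChartAt (𝓡 4) x₀) x₀ := by
    refine ContMDiffAt.comp x₀ (I' := 𝓘(ℝ, E4)) ?_ contMDiffAt_extChartAt
    exact (hF.contDiffAt (extChartAt_target_mem_nhds x₀)).contMDiffAt
  refine hFφ.congr_of_eventuallyEq ?_
  filter_upwards [chart_source_mem_nhds E4 x₀] with x hx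
  have hx' : x ∈ (extChartAt (𝓡 4) x₀).source := by rwa [extChartAt_source]
  have hb : x ∈ (trivializationAt E4 (fun x : M => Tan x) x₀).baseSet := hx
  have hsymm : ∀ a : E4, (trivializationAt E4 (fun x : M => Tan x) x₀).symm x a =
      mfderiv 𝓘(ℝ, E4) (𝓡 4) (extChartAt (𝓡 4) x₀).symm (extChartAt (𝓡 4) x₀ x) a := by
    intro a
    have := TangentBundle.symmL_trivializationAt (I := 𝓡 4) hx
    rw [ModelWithCorners.Boundaryless.range_eq_univ, mfderivWithin_univ] at this
    exact (Bundle.Trivialization.symmL_apply (R := ℝ)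
      (trivializationAt E4 (fun x : M => Tan x) x₀) hb a).symm.trans (congrArg (fun f => f a) this)
  have key : ∀ a b : E4, (B x ((trivializationAt E4 (fun x : M => Tan x) x₀).symm x a)
      ((trivializationAt E4 (fun x : M => Tan x) x₀).symm x b)) =
      B ((extChartAt (𝓡 4) x₀).symm (extChartAt (𝓡 4) x₀ x))
        (chartSymmDeriv x₀ (extChartAt (𝓡 4) x₀ x) a)
        (chartSymmDeriv x₀ (extChartAt (𝓡 4) x₀ x) b) := by
    intro a b
    rw [hsymm, hsymm]
    -- The point obtained by applying the chart and its inverse equals `x` only propositionally. All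
    -- tangent spaces are `E4` by definition, so the vectors can be kept while the base point is
    -- replaced.
    have hgen : ∀ (x' : M) (_ : x' = x) (u v : E4),
        B x (u : Tan x) (v : Tan x) = B x' (u : Tan x') (v : Tan x') := by
      rintro _ rfl u v; rfl
    exact hgen _ ((extChartAt (𝓡 4) x₀).left_inv hx') _ _
  rw [hom_trivializationAt_apply]
  refine ContinuousLinearMap.ext fun a => ContinuousLinearMap.ext fun b => ?_
  refine (inCoordinates_apply_eq₂ hb hb (by simp)).trans ?_
  have hid := Bundle.Trivial.linearMapAt_trivialization ℝ M ℝ x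
  exact (congrArg (fun L : ℝ →ₗ[ℝ] ℝ => L _) hid).trans (key a b)

end Manifold

/-! ### The metric of a symplectic triple: existence, smoothness, uniqueness. -/

section Manifold

variable {M : Type*} [TopologicalSpace M] [ChartedSpace E4 M]

theorem positiveBasis_orientation (o : ManifoldOrientation M) (x : M) :
    (positiveBasis o x).orientation = o.orient x :=
  Orientation.someBasis_orientation _ _

theorem trQ_apply (ω : Triple M 2) (x : M) : trQ ω x = ∑ i, wedge (ω i x) (ω i x) := rfl

theorem exists_tripleFrame {o : ManifoldOrientation M} {ω : Triple M 2}
    (hω : IsSymplecticTriple o ω) (x : M) :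
    ∃ e : Module.Basis (Fin 4) ℝ (Tan x), e.orientation = o.orient x ∧
      (∀ j, IsSelfDualIn e (ω j x)) ∧ trQ ω x e = 1 ∧
      (coordMatrix (fun j => ω j x) e).det ≠ 0 := by
  obtain ⟨e, he, hsd, htr⟩ := exists_selfDual_basis (positiveBasis o x) (fun j => ω j x)
    (hω.posDef x _ (positiveBasis_orientation o x))
  have ho : e.orientation = o.orient x := by
    rw [← positiveBasis_orientation o x]
    exact ((Module.Basis.orientation_eq_iff_det_pos _ _).mpr he).symm
  refine ⟨e, ho, hsd, htr, fun h => ?_⟩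
  have h₁ := (hω.posDef x e ho).det_pos
  have h₂ := det_wedgeMatrix_frame hsd
  rw [h] at h₂
  simp only [wedgeMatrix] at h₂
  change 0 < (Matrix.of fun i j => wedge (ω i x) (ω j x) e).det at h₁
  rw [h₂] at h₁
  norm_num at h₁

/-- A frame of the tangent space which is oriented and orthonormal for the metric of a triple. -/
def tripleFrame {o : ManifoldOrientation M} {ω : Triple M 2} (hω : IsSymplecticTriple o ω) (x : M) :
    Module.Basis (Fin 4) ℝ (Tan x) :=
  (exists_tripleFrame hω x).choose

theorem tripleFrame_spec {o : ManifoldOrientation M} {ω : Triple M 2}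
    (hω : IsSymplecticTriple o ω) (x : M) :
    (tripleFrame hω x).orientation = o.orient x ∧
      (∀ j, IsSelfDualIn (tripleFrame hω x) (ω j x)) ∧ trQ ω x (tripleFrame hω x) = 1 ∧
      (coordMatrix (fun j => ω j x) (tripleFrame hω x)).det ≠ 0 :=
  (exists_tripleFrame hω x).choose_spec

theorem localRep_smul {k : ℕ} (c : ℝ) (α : FormField M k) (x₀ : M) :
    localRep (c • α) x₀ = c • localRep α x₀ := rfl

theorem extD_smul {k : ℕ} (c : ℝ) (α : FormField M k) : extD (c • α) = c • extD α := by
  funext x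
  simp only [extD, localRep_smul, extDeriv_smul]
  rfl

variable [IsManifold (𝓡 4) (⊤ : ℕ∞) M]

/-- The frames may jump from point to point, but `frameInner_eq_formula`, applied to the image of a
fixed basis of `E4`, expresses the inner product through the chart coefficients of `ω`. -/
theorem contDiffOn_tripleInner {o : ManifoldOrientation M} {ω : Triple M 2}
    (hω : IsSymplecticTriple o ω) (x₀ : M) (a b : E4) :
    ContDiffOn ℝ (⊤ : ℕ∞) (fun y => frameInner (tripleFrame hω ((extChartAt (𝓡 4) x₀).symm y))
      (chartSymmDeriv x₀ y a) (chartSymmDeriv x₀ y b)) (extChartAt (𝓡 4) x₀).target := by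
  let E : Module.Basis (Fin 4) ℝ E4 := (EuclideanSpace.basisFun (Fin 4) ℝ).toBasis
  let W : E4 → Fin 3 → E4 [⋀^Fin 2]→L[ℝ] ℝ := fun y j => localRep (ω j) x₀ y
  have hW : ∀ j, SmoothCoeffs (extChartAt (𝓡 4) x₀).target fun y => W y j := fun j =>
    (hω.symplectic j).smooth.smoothCoeffs x₀
  have key : ∀ y ∈ (extChartAt (𝓡 4) x₀).target,
      0 < (wedgeMatrix (W y) E).det / (2 * (wedgeMatrix (W y) E).trace) *
        metricForm (W y) (E 0) (E 0) E ^ 2 ∧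
      frameInner (tripleFrame hω ((extChartAt (𝓡 4) x₀).symm y))
        (chartSymmDeriv x₀ y a) (chartSymmDeriv x₀ y b) =
        metricForm (W y) a b E * metricForm (W y) (E 0) (E 0) E /
          √((wedgeMatrix (W y) E).det / (2 * (wedgeMatrix (W y) E).trace) *
            metricForm (W y) (E 0) (E 0) E ^ 2) := by
    intro y hy
    obtain ⟨S, hS⟩ := chartSymmDeriv_isInvertible x₀ hy
    obtain ⟨-, hsd, htr, hD⟩ := tripleFrame_spec hω ((extChartAt (𝓡 4) x₀).symm y)
    have hε : (tripleFrame hω ((extChartAt (𝓡 4) x₀).symm y)).det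
        (fun i => chartSymmDeriv x₀ y (E i)) ≠ 0 := by
      have h := ((tripleFrame hω ((extChartAt (𝓡 4) x₀).symm y)).isUnit_det
        (E.map S.toLinearEquiv)).ne_zero
      have hE : ⇑(E.map S.toLinearEquiv) = fun i => chartSymmDeriv x₀ y (E i) := by
        funext i
        rw [← hS]
        exact Module.Basis.map_apply E S.toLinearEquiv i
      rwa [hE] at h
    have hz : chartSymmDeriv x₀ y (E 0) ≠ 0 := by
      rw [← hS]
      exact (map_ne_zero_iff S S.injective).mpr (E.ne_zero 0)
    obtain ⟨h₁, h₂⟩ := frameInner_eq_formula hsd htr hD hε hz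
    simp only [W, wedgeMatrix_localRep, metricForm_localRep]
    exact ⟨h₁, h₂ _ _⟩
  have hN : ∀ u v, ContDiffOn ℝ (⊤ : ℕ∞) (fun y => metricForm (W y) u v E)
      (extChartAt (𝓡 4) x₀).target := fun u v => contDiffOn_metricForm hW u v E
  refine ContDiffOn.congr (f := fun y => metricForm (W y) a b E *
    metricForm (W y) (E 0) (E 0) E / √((wedgeMatrix (W y) E).det /
      (2 * (wedgeMatrix (W y) E).trace) * metricForm (W y) (E 0) (E 0) E ^ 2)) ?_
    fun y hy => (key y hy).2
  refine ((hN a b).mul (hN _ _)).div (ContDiffOn.sqrt (((contDiffOn_det_wedgeMatrix hW E).div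
    (contDiffOn_const.mul (contDiffOn_trace_wedgeMatrix hW E)) fun y hy => ?_).mul
      ((hN _ _).pow 2)) fun y hy => (key y hy).1.ne') fun y hy =>
        (Real.sqrt_pos.mpr (key y hy).1).ne'
  -- A vanishing denominator would, by the convention `x / 0 = 0`, make the positive radicand zero.
  intro h0
  have h₁ := (key y hy).1
  rw [h0, div_zero, zero_mul] at h₁
  exact lt_irrefl _ h₁

/-- The Riemannian metric of a symplectic triple. -/
def tripleMetric {o : ManifoldOrientation M} {ω : Triple M 2} (hω : IsSymplecticTriple o ω) :
    Metric M where
  inner x := frameInner (tripleFrame hω x)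
  symm _ := frameInner_comm _
  pos _ _ hv := frameInner_pos _ hv
  isVonNBounded _ := frameInner_isVonNBounded _
  contMDiff := contMDiff_bilinear _ (contDiffOn_tripleInner hω)

theorem star₂_eq_hodge (o : ManifoldOrientation M) (g : Metric M) (x : M)
    (α : Tan x [⋀^Fin 2]→L[ℝ] ℝ) : star₂ o g x α = hodge (onFrame o g x) α := rfl

theorem mem_selfDual_iff {o : ManifoldOrientation M} {g : Metric M} {x : M}
    {α : Tan x [⋀^Fin 2]→L[ℝ] ℝ} :
    α ∈ selfDual o g x ↔ IsSelfDualIn (onFrame o g x) α :=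
  hodge_eq_self_iff (onFrame o g x) α

theorem tripleMetric_isTripleMetric {o : ManifoldOrientation M} {ω : Triple M 2}
    (hω : IsSymplecticTriple o ω) : IsTripleMetric o ω (tripleMetric hω) := by
  have key : ∀ x, (onFrame o (tripleMetric hω) x).det = (tripleFrame hω x).det ∧
      ∀ α, hodge (onFrame o (tripleMetric hω) x) α = hodge (tripleFrame hω x) α := fun x =>
    det_and_hodge_eq ((tripleFrame_spec hω x).1.trans (onFrame_spec o _ x).1.symm)
      (onFrame_spec o (tripleMetric hω) x).2
  constructor
  · intro x
    obtain ⟨-, hsd, -, hD⟩ := tripleFrame_spec hω x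
    ext α
    rw [SetLike.mem_coe, ← isSelfDualIn_iff_mem_span hsd hD, ← hodge_eq_self_iff, ← (key x).2]
    rfl
  · funext x
    apply four_ext (tripleFrame hω x)
    rw [(tripleFrame_spec hω x).2.2.1]
    simp [volForm, (key x).1, Module.Basis.det_self]

theorem IsTripleMetric.isSelfDualIn {o : ManifoldOrientation M} {ω : Triple M 2} {g : Metric M}
    (hg : IsTripleMetric o ω g) (x : M) (j : Fin 3) : IsSelfDualIn (onFrame o g x) (ω j x) := by
  rw [← mem_selfDual_iff, hg.selfDual_eq]
  exact Submodule.subset_span ⟨j, rfl⟩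

theorem IsTripleMetric.inner_eq {o : ManifoldOrientation M} {ω : Triple M 2} {g : Metric M}
    (hω : IsSymplecticTriple o ω) (hg : IsTripleMetric o ω g) (x : M) :
    g.inner x = frameInner (tripleFrame hω x) := by
  obtain ⟨-, hsd, htr, hD⟩ := tripleFrame_spec hω x
  rw [eq_frameInner (onFrame_spec o g x).2]
  refine (frameInner_unique hsd (hg.isSelfDualIn x) ?_ hD).symm
  -- The volume normalization shows that `tripleFrame` has determinant 1 in the `g`-orthonormal
  -- frame.
  rw [← htr, ← hg.volForm_eq]
  rfl

theorem existsUnique_tripleMetric {o : ManifoldOrientation M} {ω : Triple M 2}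
    (hω : IsSymplecticTriple o ω) : ∃! g : Metric M, IsTripleMetric o ω g := by
  refine ⟨tripleMetric hω, tripleMetric_isTripleMetric hω, fun g hg => ?_⟩
  have h : g.inner = (tripleMetric hω).inner := funext fun x => hg.inner_eq hω x
  cases g
  simp only at h
  subst h
  rfl

/-! ### The nonlinear map: self-dual values and hyperKähler zeros. -/

theorem nonlinearOp_mem_selfDual {o : ManifoldOrientation M} {ω : Triple M 2} {g : Metric M}
    (hg : IsTripleMetric o ω g) (a : Triple M 1) (j : Fin 3) (x : M) :
    (nonlinearOp o g ω a).2 j x ∈ selfDual o g x := by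
  rw [mem_selfDual_iff]
  have h₁ := isSelfDualIn_add_hodge (onFrame o g x) (extD (a j) x)
  have h₂ := IsSelfDualIn.sum (hg.isSelfDualIn x) fun k => RpMatrix o ω a x j k
  have h₃ := IsSelfDualIn.sum (ι := Bool) (ω := fun t => cond t
    ((1 / 2 : ℝ) • (extD (a j) x + hodge (onFrame o g x) (extD (a j) x)))
    (∑ k, RpMatrix o ω a x j k • ω k x)) (by rintro (_ | _); exacts [h₂, h₁]) fun _ => 1
  simpa [nonlinearOp, dPlus, star₂_eq_hodge] using h₃

omit [IsManifold (𝓡 4) (⊤ : ℕ∞) M] in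
theorem tracefreeQ_apply (ω : Triple M 2) (i j : Fin 3) (x : M) (v : Fin 4 → Tan x) :
    tracefreeQ ω i j x v =
      wedge (ω i x) (ω j x) v - if i = j then 1 / 3 * trQ ω x v else 0 := by
  unfold tracefreeQ qForm
  split_ifs <;> simp

/-- Along a zero of the nonlinear map, the mixed wedge products are the entries of `-R`. -/
theorem wedge_extD_eq {o : ManifoldOrientation M} {ω : Triple M 2} {g : Metric M}
    (hω : IsSymplecticTriple o ω) (hg : IsTripleMetric o ω g) {a : Triple M 1}
    (h : nonlinearOp o g ω a = 0) (x : M) (i j : Fin 3) :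
    wedge (ω i x) (extD (a j) x) (positiveBasis o x) = -RForm ω a j i x (positiveBasis o x) := by
  have hF : dPlus o g (a j) x + ∑ k, RpMatrix o ω a x j k • ω k x = 0 :=
    congrFun (congrFun (congrArg Prod.snd h) j) x
  have hd : dPlus o g (a j) x = ∑ k, (-RpMatrix o ω a x j k) • ω k x := by
    rw [eq_neg_of_add_eq_zero_left hF, ← Finset.sum_neg_distrib]
    exact Finset.sum_congr rfl fun k _ => (neg_smul _ _).symm
  have hq : IsUnit (coeffMatrix o (qForm ω) x).det :=
    isUnit_iff_ne_zero.mpr (hω.posDef x _ (positiveBasis_orientation o x)).det_pos.ne'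
  -- Pairing with `ω i` multiplies by `q`, which undoes `p = q⁻¹`.
  have hRpq : RpMatrix o ω a x * coeffMatrix o (qForm ω) x = coeffMatrix o (RForm ω a) x := by
    rw [RpMatrix, Matrix.mul_assoc, Matrix.nonsing_inv_mul _ hq, Matrix.mul_one]
  have hji := congrFun (congrFun hRpq j) i
  rw [wedge_selfDual _ (hg.isSelfDualIn x i), ← star₂_eq_hodge]
  change wedge (ω i x) (dPlus o g (a j) x) _ = _
  rw [hd]
  change _ = -coeffMatrix o (RForm ω a) x j i
  rw [← hji, Matrix.mul_apply]
  simp [coeffMatrix, qForm, wedgeFun, Fin.sum_univ_three]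
  ring

/-- Since `R` is symmetric, the two mixed terms give `-Q(ω) - Q(da)`. What is left of `q(ω) + q(da)`
is its trace part, whence the 4-form `(1/3)(tr q(ω) + tr q(da))`. -/
theorem isHyperkahlerTriple_of_nonlinearOp_eq_zero {o : ManifoldOrientation M} {ω : Triple M 2}
    {g : Metric M} (hω : IsSymplecticTriple o ω) (hg : IsTripleMetric o ω g) {a : Triple M 1}
    (ha : IsSymplecticTriple o (ω + tripleD a)) (h : nonlinearOp o g ω a = 0) :
    IsHyperkahlerTriple o (ω + tripleD a) := by
  refine ⟨ha, fun x => ⟨(1 / 3 : ℝ) • (trQ ω x + trQ (tripleD a) x), fun i j => ?_⟩⟩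
  apply four_ext (positiveBasis o x)
  have h₁ := wedge_extD_eq hω hg h x i j
  have h₂ := wedge_extD_eq hω hg h x j i
  have hexp : qForm (ω + tripleD a) i j x (positiveBasis o x) =
      wedge (ω i x) (ω j x) (positiveBasis o x) +
      wedge (ω i x) (extD (a j) x) (positiveBasis o x) +
      wedge (ω j x) (extD (a i) x) (positiveBasis o x) +
      wedge (extD (a i) x) (extD (a j) x) (positiveBasis o x) := by
    simp [qForm, tripleD, wedgeFun]
    ring
  rw [hexp, h₁, h₂]
  simp only [RForm, ContinuousAlternatingMap.add_apply, ContinuousAlternatingMap.smul_apply,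
    smul_eq_mul, tracefreeQ_apply, wedge_comm (ω j x) (ω i x),
    wedge_comm (tripleD a j x) (tripleD a i x)]
  change _ + _ + _ + wedge (tripleD a i x) (tripleD a j x) (positiveBasis o x) = _
  rcases eq_or_ne i j with rfl | hij
  · simp only [if_true, ContinuousAlternatingMap.add_apply, ContinuousAlternatingMap.smul_apply,
      smul_eq_mul]
    ring
  · simp only [if_neg hij, if_neg hij.symm, ContinuousAlternatingMap.coe_zero, Pi.zero_apply]
    ring

/-! ### Linearization at zero. -/

theorem star₁_smul (o : ManifoldOrientation M) (g : Metric M) (c : ℝ) (α : FormField M 1) :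
    star₁ o g (c • α) = c • star₁ o g α := by
  funext x
  ext v
  have hs : ∀ (s : Fin 4 → Tan x [⋀^Fin 3]→ₗ[ℝ] ℝ) (w : Fin 3 → Tan x),
      (∑ i, s i) w = ∑ i, s i w := by
    intro s w; simp [Fin.sum_univ_four]
  simp only [star₁, toContinuousForm_apply, hs, Pi.smul_apply,
    ContinuousAlternatingMap.smul_apply, AlternatingMap.smul_apply, smul_eq_mul, Finset.mul_sum,
    mul_assoc]

theorem codiff_smul (o : ManifoldOrientation M) (g : Metric M) (c : ℝ) (α : FormField M 1)
    (x : M) : codiff o g (c • α) x = c * codiff o g α x := by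
  simp [codiff, star₄, star₁_smul, extD_smul]

theorem dPlus_smul (o : ManifoldOrientation M) (g : Metric M) (c : ℝ) (α : FormField M 1)
    (x : M) : dPlus o g (c • α) x = c • dPlus o g α x := by
  have h := hodge_smul (onFrame o g x) c (extD α x)
  rw [dPlus, extD_smul]
  refine (congrArg (fun β => (1 / 2 : ℝ) • (c • extD α x + β)) h).trans ?_
  ext v
  simp only [dPlus, star₂_eq_hodge, ContinuousAlternatingMap.add_apply,
    ContinuousAlternatingMap.smul_apply, smul_eq_mul]
  ring

omit [IsManifold (𝓡 4) (⊤ : ℕ∞) M] in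
/-- The zeroth order term of the nonlinear map is quadratic up to a constant. -/
theorem RpMatrix_smul (o : ManifoldOrientation M) (ω : Triple M 2) (b : Triple M 1) (x : M)
    (t : ℝ) :
    RpMatrix o ω (t • b) x = RpMatrix o ω 0 x +
      t ^ 2 • (coeffMatrix o (fun i j y => (1 / 2 : ℝ) • tracefreeQ (tripleD b) i j y) x *
        (coeffMatrix o (qForm ω) x)⁻¹) := by
  have h : coeffMatrix o (RForm ω (t • b)) x = coeffMatrix o (RForm ω 0) x +
      t ^ 2 • coeffMatrix o (fun i j y => (1 / 2 : ℝ) • tracefreeQ (tripleD b) i j y) x := by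
    have hb : ∀ j, tripleD (t • b) j x = t • tripleD b j x := fun j =>
      congrFun (extD_smul t (b j)) x
    have h0 : ∀ j, tripleD (0 : Triple M 1) j x = 0 := fun j => by
      have h₁ := congrFun (extD_smul (0 : ℝ) (b j)) x
      rw [zero_smul, zero_smul] at h₁
      exact h₁
    ext i j
    simp only [coeffMatrix, Matrix.of_apply, Matrix.add_apply, Matrix.smul_apply, RForm,
      ContinuousAlternatingMap.add_apply, ContinuousAlternatingMap.smul_apply, smul_eq_mul,
      tracefreeQ_apply, trQ_apply, hb, h0, wedge_apply,
      wedgeFun, ContinuousAlternatingMap.coe_zero, Pi.zero_apply, Fin.sum_univ_three]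
    split_ifs <;> ring
  rw [RpMatrix, h, Matrix.add_mul, Matrix.smul_mul]
  rfl

/-- Along the ray `t • b` the map is an explicit quadratic polynomial in `t`, by homogeneity of `d*`
and `d₊`. The constant term, coming from `Q(ω)`, need not vanish. -/
theorem hasDerivAt_nonlinearOp (o : ManifoldOrientation M) (g : Metric M) (ω : Triple M 2)
    (b : Triple M 1) (j : Fin 3) (x : M) :
    HasDerivAt (fun t : ℝ => (nonlinearOp o g ω (t • b)).1 j x) ((diracOp o g b).1 j x) 0 ∧
    ∀ v : Fin 2 → Tan x,
      HasDerivAt (fun t : ℝ => (nonlinearOp o g ω (t • b)).2 j x v)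
        ((diracOp o g b).2 j x v) 0 := by
  constructor
  · have h : (fun t : ℝ => (nonlinearOp o g ω (t • b)).1 j x) =
        fun t => t * codiff o g (b j) x := funext fun t => codiff_smul o g t (b j) x
    rw [h]
    simpa [diracOp] using! (hasDerivAt_id (0 : ℝ)).mul_const (codiff o g (b j) x)
  · intro v
    obtain ⟨B, hB⟩ : ∃ B : Matrix (Fin 3) (Fin 3) ℝ, ∀ t : ℝ,
        RpMatrix o ω (t • b) x = RpMatrix o ω 0 x + t ^ 2 • B := ⟨_, RpMatrix_smul o ω b x⟩
    have h : (fun t : ℝ => (nonlinearOp o g ω (t • b)).2 j x v) = fun t =>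
        t * dPlus o g (b j) x v + (∑ k, RpMatrix o ω 0 x j k * ω k x v +
          t ^ 2 * ∑ k, B j k * ω k x v) := by
      funext t
      have hd := congrArg (fun α => α v) (dPlus_smul o g t (b j) x)
      change (dPlus o g (t • b j) x + ∑ k, RpMatrix o ω (t • b) x j k • ω k x) v = _
      simp only [ContinuousAlternatingMap.smul_apply, smul_eq_mul] at hd
      rw [ContinuousAlternatingMap.add_apply, hd, hB]
      simp only [ContinuousAlternatingMap.sum_apply, ContinuousAlternatingMap.smul_apply,
        Matrix.add_apply, Matrix.smul_apply, smul_eq_mul, add_mul, Finset.sum_add_distrib,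
        Finset.mul_sum, mul_assoc]
    rw [h]
    have h₁ := ((hasDerivAt_id (0 : ℝ)).mul_const (dPlus o g (b j) x v)).add
      (((hasDerivAt_pow 2 (0 : ℝ)).mul_const (∑ k, B j k * ω k x v)).const_add
        (∑ k, RpMatrix o ω 0 x j k * ω k x v))
    simpa [diracOp] using! h₁

end Manifold

end HKTriple

end

theorem mainTheorem10 {M : Type*} [TopologicalSpace M] [ChartedSpace HKTriple.E4 M]
    [IsManifold (𝓡 4) (⊤ : ℕ∞) M] (o : HKTriple.ManifoldOrientation M) (ω : HKTriple.Triple M 2)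
    (hω : HKTriple.IsSymplecticTriple o ω) :
    (∃! g : HKTriple.Metric M, HKTriple.IsTripleMetric o ω g) ∧
    ∀ g : HKTriple.Metric M, HKTriple.IsTripleMetric o ω g →
      -- the second component of `F` takes values in self-dual forms
      (∀ a : HKTriple.Triple M 1, (∀ j, HKTriple.IsSmoothForm (a j)) →
        ∀ j x, (HKTriple.nonlinearOp o g ω a).2 j x ∈ HKTriple.selfDual o g x) ∧
      -- zeros of `F` give hyperKähler triples
      (∀ a : HKTriple.Triple M 1, (∀ j, HKTriple.IsSmoothForm (a j)) →
        HKTriple.IsSymplecticTriple o (ω + HKTriple.tripleD a) →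
        HKTriple.nonlinearOp o g ω a = 0 →
        HKTriple.IsHyperkahlerTriple o (ω + HKTriple.tripleD a)) ∧
      -- the linearization of `F` at `0` is the tripled Dirac operator
      (∀ b : HKTriple.Triple M 1, (∀ j, HKTriple.IsSmoothForm (b j)) →
        ∀ (j : Fin 3) (x : M),
          HasDerivAt (fun t : ℝ => (HKTriple.nonlinearOp o g ω (t • b)).1 j x)
            ((HKTriple.diracOp o g b).1 j x) 0 ∧
          ∀ v : Fin 2 → HKTriple.Tan x,
            HasDerivAt (fun t : ℝ => (HKTriple.nonlinearOp o g ω (t • b)).2 j x v)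
              ((HKTriple.diracOp o g b).2 j x v) 0) := by
  refine ⟨HKTriple.existsUnique_tripleMetric hω, fun g hg => ⟨fun a _ j x => ?_, fun a _ ha h => ?_,
    fun b _ j x => ?_⟩⟩
  · exact HKTriple.nonlinearOp_mem_selfDual hg a j x
  · exact HKTriple.isHyperkahlerTriple_of_nonlinearOp_eq_zero hω hg ha h
  · exact HKTriple.hasDerivAt_nonlinearOp o g ω b j x
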